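/- Let $n\ge 2$. For each $k\ge 0$ let $H_k$ be the space of real homogeneous harmonic polynomials of degree $k$ on $\mathbb{R}^n$, let $d_k=\dim H_k$, and let $Y_{k,1},\dots,Y_{k,d_k}$ be a basis of $H_k$ whose restrictions to the sphere $\mathbb{S}^{n-1}$ are orthonormal for the surface measure normalized to total mass $1$. The Klein--Dirac quadric is $\mathrm{KDQ}=(\mathbb{C}\times\mathbb{S}^{n-1})/\mathbb{Z}_2$, the quotient space in which $(\zeta,\theta)$ and $(-\zeta,-\theta)$ are identified; the class of $(\zeta,\theta)$ is written $\zeta\theta$, and $B_R=\{\zeta\theta: |\zeta|<R\}$. For $\theta\in\mathbb{S}^{n-1}$ and $x\in\mathbb{R}^n$ with $|x|<|\zeta|$ let $$r(\zeta\theta-x)=\sqrt{\zeta^2-2\zeta\langle\theta,x\rangle+|x|^2},$$ with the branch that is continuous in $x$ and equal to $\zeta$ at $x=0$. For a signed measure $\mu$ on $\mathbb{R}^n$ put $$\widehat\mu(\zeta,\theta)=\int \frac{\zeta^{n-1}}{r(\zeta\theta-x)^n}\,d\mu(x),$$ and let the component measure $\mu_{k,\ell}$ be the signed measure on $[0,\infty)$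 with $\int_0^\infty F(r)\,d\mu_{k,\ell}(r)=\int_{\mathbb{R}^n}F(|x|)\,Y_{k,\ell}(x/|x|)\,d\mu(x)$ for all continuous compactly supported $F$ (at $x=0$ the factor $Y_{k,\ell}(x/|x|)$ is read as the constant $Y_{0,1}$ if $k=0$ and as $0$ if $k\ge1$). Let $R>0$ and let $\mu$ be a signed measure of finite variation on $\mathbb{R}^n$ supported in the closed ball $\{|x|\le R\}$. Then for all $\zeta\in\mathbb{C}$ with $|\zeta|>R$ and all $\theta\in\mathbb{S}^{n-1}$ the integrals defining $\widehat\mu(\zeta,\theta)$ and those in the series below converge absolutely, and $$\widehat\mu(\zeta,\theta)=\sum_{k=0}^\infty\sum_{\ell=1}^{d_k}\zeta^{-k+1}\,Y_{k,\ell}(\theta)\int_{[0,R]}\frac{r^k}{\zeta^2-r^2}\,d\mu_{k,\ell}(r),$$ where the family of all terms indexed by $(k,\ell)$ is absolutely summable. The series converges absolutely and uniformly on compact sets outside the closed ball: for every compact $K\subset\mathrm{KDQ}\setminus\overline{B_R}$ there are numbers $M_{k,\ell}$ with $\sum_{k,\ell}M_{k,\ell}<\infty$ such that the $(k,\ell)$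 term has absolute value at most $M_{k,\ell}$ at all $(\zeta,\theta)$ with $\zeta\theta\in K$. -/

import Mathlib

open MeasureTheory Metric Set
open scoped InnerProductSpace

noncomputable section

/-- Euclidean space `ℝⁿ`. -/
abbrev EucSpace (n : ℕ) : Type := EuclideanSpace ℝ (Fin n)

/-- The unit sphere `𝕊ⁿ⁻¹` in `ℝⁿ`. -/
abbrev UnitSphere (n : ℕ) : Type := sphere (0 : EucSpace n) 1

/-! ### The Klein-Dirac quadric -/

/-- The antipodal identification `(ζ, θ) ∼ (-ζ, -θ)` on `ℂ × 𝕊ⁿ⁻¹`. -/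
def kdqSetoid (n : ℕ) : Setoid (ℂ × UnitSphere n) where
  r p q := p = q ∨ p = (-q.1, -q.2)
  iseqv :=
    { refl := fun _ => Or.inl rfl
      symm := by
        rintro p q (h | h)
        · exact Or.inl h.symm
        · right; subst h; simp
      trans := by
        rintro p q r (h | h) (h' | h') <;> subst h <;> subst h' <;> simp }

/-- The Klein-Dirac quadric `KDQ = (ℂ × 𝕊ⁿ⁻¹) / ℤ₂`. -/
def KDQ (n : ℕ) : Type := Quotient (kdqSetoid n)

/-- The quotient topology on the Klein-Dirac quadric. -/
instance KDQ.instTopologicalSpace (n : ℕ) : TopologicalSpace (KDQ n) :=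
  inferInstanceAs (TopologicalSpace (Quotient (kdqSetoid n)))

/-- The point `ζθ` of the Klein-Dirac quadric. -/
def KDQ.mk {n : ℕ} (ζ : ℂ) (θ : UnitSphere n) : KDQ n :=
  Quotient.mk (kdqSetoid n) (ζ, θ)

/-- The ball `B_R = {ζθ : |ζ| < R}` in the Klein-Dirac quadric. -/
def KDQ.ball (n : ℕ) (R : ℝ) : Set (KDQ n) :=
  {p | ∃ (ζ : ℂ) (θ : UnitSphere n), ‖ζ‖ < R ∧ p = KDQ.mk ζ θ}

/-! ### Spherical harmonics -/

/-- The Laplacian `∑ ∂²/∂xᵢ²` on real polynomials in `n` variables. -/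
def polyLaplacian (n : ℕ) : MvPolynomial (Fin n) ℝ →ₗ[ℝ] MvPolynomial (Fin n) ℝ :=
  ∑ i : Fin n,
    (MvPolynomial.pderiv i).toLinearMap ∘ₗ (MvPolynomial.pderiv (R := ℝ) i).toLinearMap

/-- The real vector space of harmonic polynomials on `ℝⁿ` that are homogeneous of degree `k`;
restriction to the unit sphere identifies it with the space of spherical harmonics of degree `k`. -/
def harmonicSpace (n k : ℕ) : Submodule ℝ (MvPolynomial (Fin n) ℝ) :=
  MvPolynomial.homogeneousSubmodule (Fin n) ℝ k ⊓ LinearMap.ker (polyLaplacian n)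

/-- The number `d_k`, the dimension of the space of spherical harmonics of degree `k`. -/
def harmonicDim (n k : ℕ) : ℕ := Module.finrank ℝ (harmonicSpace n k)

/-- The value of a homogeneous harmonic polynomial at a point of `ℝⁿ`. -/
def harmonicEval {n k : ℕ} (p : harmonicSpace n k) (x : EucSpace n) : ℝ :=
  MvPolynomial.eval (fun i => x i) (p : MvPolynomial (Fin n) ℝ)

/-- `Y k 0, …, Y k (d_k - 1)` is an orthonormal basis of the spherical harmonics of degree `k`,
for the normalized (total mass one) surface measure on the unit sphere. -/
def IsOrthonormalHarmonicBasis (n : ℕ)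
    (Y : ∀ k : ℕ, Module.Basis (Fin (harmonicDim n k)) ℝ (harmonicSpace n k)) : Prop :=
  ∀ (k : ℕ) (l m : Fin (harmonicDim n k)),
    (⨍ θ : UnitSphere n, harmonicEval (Y k l) θ * harmonicEval (Y k m) θ
      ∂((volume : Measure (EucSpace n)).toSphere)) = if l = m then 1 else 0

/-! ### The Hua-Aronszajn kernel and the Stieltjes-Markov transform -/

/-- `r(ζθ - x)`: the square root of `ζ² - 2ζ⟨θ, x⟩ + |x|²`, on the branch that, for `|x| < |ζ|`,
is continuous in `x` and equals `ζ` at `x = 0`. -/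
def aronszajnRoot {n : ℕ} (ζ : ℂ) (θ x : EucSpace n) : ℂ :=
  ζ * (1 - 2 * (⟪θ, x⟫_ℝ : ℂ) / ζ + (‖x‖ : ℂ) ^ 2 / ζ ^ 2) ^ (1 / 2 : ℂ)

theorem aronszajnRoot_sq {n : ℕ} {ζ : ℂ} (hζ : ζ ≠ 0) (θ x : EucSpace n) :
    aronszajnRoot ζ θ x ^ 2 = ζ ^ 2 - 2 * ζ * (⟪θ, x⟫_ℝ : ℂ) + (‖x‖ : ℂ) ^ 2 := by
  unfold aronszajnRoot
  rw [mul_pow, ← Complex.cpow_nat_mul]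
  norm_num
  field_simp

/-- For `|x| < |ζ|` the principal root in `aronszajnRoot` is taken off its branch cut. -/
theorem aronszajnRoot_slitPlane {n : ℕ} {ζ : ℂ} {θ x : EucSpace n} (hθ : ‖θ‖ = 1)
    (hx : ‖x‖ < ‖ζ‖) :
    1 - 2 * (⟪θ, x⟫_ℝ : ℂ) / ζ + (‖x‖ : ℂ) ^ 2 / ζ ^ 2 ∈ Complex.slitPlane := by
  have hζ : 0 < ‖ζ‖ := (norm_nonneg x).trans_lt hx
  have hs : |⟪θ, x⟫_ℝ| ≤ ‖x‖ := by simpa [hθ] using abs_real_inner_le_norm θ x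
  have hu : ‖x‖ ^ 2 * (ζ⁻¹.re ^ 2 + ζ⁻¹.im ^ 2) < 1 := by
    have h1 : ζ⁻¹.re ^ 2 + ζ⁻¹.im ^ 2 = ‖ζ⁻¹‖ ^ 2 := by
      rw [← Complex.normSq_eq_norm_sq, Complex.normSq_apply]; ring
    rw [h1, norm_inv, ← mul_pow]
    have : ‖x‖ * ‖ζ‖⁻¹ < 1 := by
      rw [← div_eq_mul_inv]; exact (div_lt_one hζ).2 hx
    have h0 : 0 ≤ ‖x‖ * ‖ζ‖⁻¹ := by positivity
    nlinarith
  rw [div_eq_mul_inv, div_eq_mul_inv, ← inv_pow]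
  generalize ζ⁻¹ = u at hu
  generalize ⟪θ, x⟫_ℝ = s at hs
  have hρ := norm_nonneg x
  generalize ‖x‖ = ρ at hu hs hρ
  obtain ⟨p, q⟩ := u
  rw [Complex.mem_slitPlane_iff]
  simp [pow_two] at hu ⊢
  by_cases hq : q = 0
  · left
    subst hq
    obtain ⟨h1, h2⟩ := abs_le.1 hs
    have h3 : ρ * |p| < 1 := by
      by_contra hcon
      have := abs_mul_abs_self p
      nlinarith
    have h4 : s * p ≤ ρ * |p| := by
      calc s * p ≤ |s * p| := le_abs_self _
        _ = |s| * |p| := abs_mul _ _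
        _ ≤ _ := by gcongr
    have := abs_mul_abs_self p
    nlinarith [sq_nonneg (1 - ρ * |p|), mul_pos (sub_pos.2 h3) (sub_pos.2 h3)]
  · by_cases h : s = ρ * ρ * p
    · left; subst h; nlinarith
    · right
      intro h'
      apply h
      have : q * (s - ρ * ρ * p) = 0 := by linarith
      rcases mul_eq_zero.1 this with h0 | h0
      · exact absurd h0 hq
      · linarith

/-- The Hua-Aronszajn kernel `K(ζθ; x) = ζⁿ⁻¹ / r(ζθ - x)ⁿ`. -/
def huaAronszajnKernel (n : ℕ) (ζ : ℂ) (θ x : EucSpace n) : ℂ :=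
  ζ ^ (n - 1) / aronszajnRoot ζ θ x ^ n

/-- The multidimensional Stieltjes-Markov transform of a signed measure on `ℝⁿ`. -/
def stieltjesMarkov {n : ℕ} (μ : SignedMeasure (EucSpace n)) (ζ : ℂ) (θ : UnitSphere n) : ℂ :=
  ∫ᵛ x, huaAronszajnKernel n ζ θ x ∂<•μ

/-! ### Component measures -/

/-- The component measure of `μ` with respect to `p`: the image under `x ↦ |x|` of the signed
measure `p(x/|x|) dμ(x)`. It is carried by `[0, ∞)`. At `x = 0` the convention `x/|x| = 0` is in
force, so `p(x/|x|)` is there the constant `p` in degree `0`, and `0` in positive degree. -/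
def componentMeasure {n k : ℕ} (μ : SignedMeasure (EucSpace n)) (p : harmonicSpace n k) :
    SignedMeasure ℝ :=
  (VectorMeasure.withDensity μ (fun x : EucSpace n => harmonicEval p (‖x‖⁻¹ • x))
    (ContinuousLinearMap.lsmul ℝ ℝ)).map (fun x : EucSpace n => ‖x‖)

theorem norm_normalize_le_one {n : ℕ} (x : EucSpace n) : ‖‖x‖⁻¹ • x‖ ≤ 1 := by
  rw [norm_smul, norm_inv, norm_norm]
  exact inv_mul_le_one

theorem continuous_harmonicEval {n k : ℕ} (p : harmonicSpace n k) :
    Continuous (harmonicEval p) := by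
  unfold harmonicEval
  exact (MvPolynomial.continuous_eval _).comp (by fun_prop)

theorem measurable_harmonicEval_normalize {n k : ℕ} (p : harmonicSpace n k) :
    Measurable (fun x : EucSpace n => harmonicEval p (‖x‖⁻¹ • x)) :=
  (continuous_harmonicEval p).measurable.comp (by fun_prop)

theorem exists_bound_harmonicEval {n k : ℕ} (p : harmonicSpace n k) :
    ∃ C : ℝ, ∀ x : EucSpace n, ‖harmonicEval p (‖x‖⁻¹ • x)‖ ≤ C := by
  obtain ⟨C, hC⟩ := (isCompact_closedBall (0 : EucSpace n) 1).exists_bound_of_continuousOn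
    (continuous_harmonicEval p).continuousOn
  exact ⟨C, fun x => hC _ (by simpa using norm_normalize_le_one x)⟩

/-- Integration against a signed measure with a bounded density. -/
theorem integral_withDensity_bounded {X : Type*} [MeasurableSpace X] (μ : SignedMeasure X)
    {g f : X → ℝ} (hg : Measurable g) {C : ℝ} (hC : ∀ x, ‖g x‖ ≤ C)
    (hf : StronglyMeasurable f) {D : ℝ} (hD : ∀ x, ‖f x‖ ≤ D) :
    ∫ᵛ x, f x ∂<•(VectorMeasure.withDensity μ g (ContinuousLinearMap.lsmul ℝ ℝ)) =
      ∫ᵛ x, f x * g x ∂<•μ := by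
  have hfin : ∀ ν : SignedMeasure X, IsFiniteMeasure ν.variation := fun ν => by
    rw [← SignedMeasure.totalVariation_eq_variation]; infer_instance
  have hfμ := hfin μ
  have hgi : VectorMeasure.Integrable μ g :=
    Integrable.of_bound hg.aestronglyMeasurable C (Filter.Eventually.of_forall hC)
  set ν := VectorMeasure.withDensity μ g (ContinuousLinearMap.lsmul ℝ ℝ) with hν
  have hfν := hfin ν
  rcases isEmpty_or_nonempty X with hX | ⟨⟨x₀⟩⟩
  · simp [VectorMeasure.integral_of_isEmpty]
  have hD0 : 0 ≤ D := (norm_nonneg _).trans (hD x₀)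
  have hSi : ∀ (ρ : SignedMeasure X) (s : SimpleFunc X ℝ), VectorMeasure.Integrable ρ s :=
    fun ρ s => by have := hfin ρ; exact s.integrable_of_isFiniteMeasure
  have hSgi : ∀ s : SimpleFunc X ℝ, VectorMeasure.Integrable μ (fun x => s x * g x) :=
    fun s => (hSi μ s).mul_bdd (c := C) hg.aestronglyMeasurable (Filter.Eventually.of_forall hC)
  have key : ∀ s : SimpleFunc X ℝ, ∫ᵛ x, s x ∂<•ν = ∫ᵛ x, s x * g x ∂<•μ := by
    intro s
    induction s using SimpleFunc.induction with
    | const c hs =>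
      rename_i s
      have h1 : ∀ x, s.indicator (fun _ : X => c) x * g x = c • s.indicator g x := fun x => by
        by_cases hx : x ∈ s <;> simp [hx]
      have h2 : (⇑((SimpleFunc.const X c).piecewise s hs (SimpleFunc.const X 0)) : X → ℝ)
          = s.indicator (fun _ => c) := by
        classical
        ext x; by_cases hx : x ∈ s <;> simp [hx]
      simp only [h2, h1]
      rw [VectorMeasure.integral_indicator_const _ hs, hν, VectorMeasure.withDensity_apply hgi,
        VectorMeasure.integral_fun_smul,
        VectorMeasure.integral_indicator hs]
      have h3 : (ContinuousLinearMap.lsmul ℝ ℝ : ℝ →L[ℝ] ℝ →L[ℝ] ℝ).flip =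
          ContinuousLinearMap.lsmul ℝ ℝ := by
        ext; simp
      rw [h3]
      simp
    | add _ h1 h2 =>
      simp only [SimpleFunc.coe_add, Pi.add_apply, add_mul]
      rw [VectorMeasure.integral_fun_add (hSi _ _) (hSi _ _),
        VectorMeasure.integral_fun_add (hSgi _) (hSgi _), h1, h2]
  have hl : Filter.Tendsto (fun n : ℕ => ∫ᵛ x, hf.approxBounded D n x ∂<•ν) Filter.atTop
      (nhds (∫ᵛ x, f x ∂<•ν)) := by
    apply VectorMeasure.tendsto_integral_of_dominated_convergence (fun _ => D)
    · exact fun n => (hSi ν _).1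
    · exact integrable_const D
    · exact fun n => Filter.Eventually.of_forall fun x => hf.norm_approxBounded_le hD0 n x
    · exact Filter.Eventually.of_forall fun x => hf.tendsto_approxBounded_of_norm_le (hD x)
  have hr : Filter.Tendsto (fun n : ℕ => ∫ᵛ x, hf.approxBounded D n x * g x ∂<•μ) Filter.atTop
      (nhds (∫ᵛ x, f x * g x ∂<•μ)) := by
    apply VectorMeasure.tendsto_integral_of_dominated_convergence (fun _ => D * C)
    · exact fun n => (hSgi _).1
    · exact integrable_const _
    · refine fun n => Filter.Eventually.of_forall fun x => ?_
      rw [norm_mul]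
      exact mul_le_mul (hf.norm_approxBounded_le hD0 n x) (hC x) (norm_nonneg _) hD0
    · exact Filter.Eventually.of_forall fun x =>
        (hf.tendsto_approxBounded_of_norm_le (hD x)).mul_const _
  simp only [key] at hl
  exact tendsto_nhds_unique hl hr

/-- The defining identity of the component measures. -/
theorem integral_componentMeasure {n k : ℕ} (μ : SignedMeasure (EucSpace n))
    (p : harmonicSpace n k) {F : ℝ → ℝ} (hF : Continuous F) (hc : HasCompactSupport F) :
    ∫ᵛ r, F r ∂<•(componentMeasure μ p) =
      ∫ᵛ x, F ‖x‖ * harmonicEval p (‖x‖⁻¹ • x) ∂<•μ := by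
  obtain ⟨C, hC⟩ := exists_bound_harmonicEval p
  obtain ⟨D, hD⟩ := hF.bounded_above_of_compact_support hc
  have hFn : Continuous (fun x : EucSpace n => F ‖x‖) := hF.comp continuous_norm
  unfold componentMeasure
  rw [VectorMeasure.integral_map measurable_norm hF.aestronglyMeasurable]
  · exact integral_withDensity_bounded μ (measurable_harmonicEval_normalize p) hC
      hFn.stronglyMeasurable (fun x => hD _)
  · rw [VectorMeasure.Integrable, ← SignedMeasure.totalVariation_eq_variation]
    exact Integrable.of_bound hFn.aestronglyMeasurable D (Filter.Eventually.of_forall fun x => hD _)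

end

/-! Everything rests on the Poisson kernel expansion with a complex parameter. For unit vectors θ, y
and |w| < 1, (1 - w²)(1 - 2⟨θ,y⟩w + w²)^(-n/2) = ∑ₖ Zₖ(θ,y) wᵏ, where Zₖ is the zonal harmonic of
degree k. Writing x = |x|y, putting w = |x|/ζ and dividing by ζ(1 - w²) turns the left side into the
Hua-Aronszajn kernel and the k-th term into ζ^(1-k) |x|ᵏ/(ζ² - |x|²) · Zₖ(θ,y). The addition theorem
Zₖ(θ,y) = ∑ₗ Yₖₗ(θ)Yₖₗ(y) separates the variables, and integrating termwise against μ gives the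
series (`hasSum_kernelTerm`, `integral_kernelTerm`).

The addition theorem is proved from scratch. The coefficients of the generating function are defined
by a recurrence in an arbitrary real algebra, so the same sequence serves as polynomials in x (where
it is harmonic, `polyLaplacian_zonalSeq`) and as numbers. The reproducing property of Zₖ is first
obtained for any linear functional E on polynomials with E(xᵢf) = E(∂ᵢf), then for the Gaussian
integral, and polar coordinates carry it to the sphere (`average_zonalHarmonic_mul`). Expanding Zₖ
in the basis then gives the addition theorem.

For convergence, |Yₖₗ(θ)Yₖₗ(y)| ≤ Zₖ(1), the value of Zₖ at its pole, and dₖ = Zₖ(1). If |x| ≤ R <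
R' ≤ |ζ|, the terms of the kernel series are therefore dominated by a constant times ∑ₖ Zₖ(1)²
(R/R')ᵏ, which converges because the Poisson series does throughout the unit disc. This one majorant
gives dominated convergence, absolute summability and uniformity on compact sets. -/

noncomputable section

/-! ### Gegenbauer sequences -/

section Gegenbauer

variable {A B : Type*} [CommRing A] [Algebra ℝ A] [CommRing B] [Algebra ℝ B]

/-- The homogenized Gegenbauer sequence: the coefficients of `(1 - 2 s w + ρ w²) ^ (-ν)`
as a power series in `w`. -/
def gegenbauer (ν : ℝ) (s ρ : A) : ℕ → A
  | 0 => 1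
  | 1 => (2 * ν) • s
  | k + 2 => ((k : ℝ) + 2)⁻¹ • ((2 * (k + 1 + ν)) • (s * gegenbauer ν s ρ (k + 1)) -
      (k + 2 * ν) • (ρ * gegenbauer ν s ρ k))

theorem algebraMap_real_two : algebraMap ℝ A 2 = 2 := map_ofNat _ 2

theorem gegenbauer_zero (ν : ℝ) (s ρ : A) : gegenbauer ν s ρ 0 = 1 := by
  rw [gegenbauer]

theorem gegenbauer_one (ν : ℝ) (s ρ : A) :
    gegenbauer ν s ρ 1 = 2 * algebraMap ℝ A ν * s := by
  rw [gegenbauer, Algebra.smul_def]; simp [algebraMap_real_two]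

/-- Positive integers are units in a real algebra, so the recurrences below can be kept free of
denominators. -/
theorem natCast_add_one_mul_cancel {k : ℕ} {x y : A}
    (h : ((k : A) + 1) * x = ((k : A) + 1) * y) : x = y := by
  have hu : IsUnit ((k : A) + 1) := by
    have : ((k : A) + 1) = algebraMap ℝ A (k + 1) := by simp
    rw [this]
    exact (IsUnit.mk0 _ (by positivity)).map _
  exact hu.mul_left_cancel h

theorem gegenbauer_succ_succ (ν : ℝ) (s ρ : A) (k : ℕ) :
    ((k : A) + 2) * gegenbauer ν s ρ (k + 2) =
      2 * (k + 1 + algebraMap ℝ A ν) * s * gegenbauer ν s ρ (k + 1) -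
        (k + 2 * algebraMap ℝ A ν) * ρ * gegenbauer ν s ρ k := by
  have h2 : ((k : A) + 2) = algebraMap ℝ A (k + 2) := by simp [algebraMap_real_two]
  have h3 : ((k : ℝ) + 2) ≠ 0 := by positivity
  rw [gegenbauer, h2, ← Algebra.smul_def, smul_smul, mul_inv_cancel₀ h3, one_smul,
    Algebra.smul_def, Algebra.smul_def]
  simp only [map_add, map_mul, algebraMap_real_two, map_natCast, map_one]
  ring

theorem map_gegenbauer (f : A →ₐ[ℝ] B) (ν : ℝ) (s ρ : A) (k : ℕ) :
    f (gegenbauer ν s ρ k) = gegenbauer ν (f s) (f ρ) k := by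
  induction k using Nat.twoStepInduction with
  | zero => simp [gegenbauer]
  | one => simp [gegenbauer]
  | more k h0 h1 => simp [gegenbauer, h0, h1]

/-- Uniqueness of the solution of the three-term recurrence. -/
theorem eq_gegenbauer_of_recurrence {ν : ℝ} {s ρ : A} {c : ℕ → A} (h0 : c 0 = 1)
    (h1 : c 1 = 2 * algebraMap ℝ A ν * s)
    (h : ∀ k : ℕ, ((k : A) + 2) * c (k + 2) =
      2 * (k + 1 + algebraMap ℝ A ν) * s * c (k + 1) -
        (k + 2 * algebraMap ℝ A ν) * ρ * c k) (k : ℕ) : c k = gegenbauer ν s ρ k := by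
  induction k using Nat.twoStepInduction with
  | zero => rw [h0, gegenbauer_zero]
  | one => rw [h1, gegenbauer_one]
  | more k e0 e1 =>
    have := gegenbauer_succ_succ ν s ρ k
    rw [← e0, ← e1, ← h] at this
    refine (natCast_add_one_mul_cancel (k := k + 1) ?_).symm
    push_cast
    linear_combination this

/-- With G_ν = (1 - 2sw + ρw²)^(-ν), these are the coefficients of G_ν' = 2ν(s - ρw)G_{ν+1} and of
wG_ν' + νG_ν = ν(1 - ρw²)G_{ν+1}. They are proved jointly because the induction for the first uses
the second. -/
theorem gegenbauer_mul_succ (ν : ℝ) (s ρ : A) (k : ℕ) :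
    (((k : A) + 1) * gegenbauer ν s ρ (k + 1) =
      2 * algebraMap ℝ A ν * (s * gegenbauer (ν + 1) s ρ k -
        if k = 0 then 0 else ρ * gegenbauer (ν + 1) s ρ (k - 1))) ∧
    ((k + 1 + algebraMap ℝ A ν) * gegenbauer ν s ρ (k + 1) =
      algebraMap ℝ A ν * (gegenbauer (ν + 1) s ρ (k + 1) -
        if k = 0 then 0 else ρ * gegenbauer (ν + 1) s ρ (k - 1))) := by
  -- The recurrence for exponent ν + 1 deduces the second identity from the first, so only the first
  -- has to be carried through the induction.
  have key : ∀ k : ℕ, (((k : A) + 2) * gegenbauer ν s ρ (k + 2) =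
      2 * algebraMap ℝ A ν * (s * gegenbauer (ν + 1) s ρ (k + 1) -
        ρ * gegenbauer (ν + 1) s ρ k)) →
      ((k + 2 + algebraMap ℝ A ν) * gegenbauer ν s ρ (k + 2) =
      algebraMap ℝ A ν * (gegenbauer (ν + 1) s ρ (k + 2) -
        ρ * gegenbauer (ν + 1) s ρ k)) := by
    intro k hk
    refine natCast_add_one_mul_cancel (k := k + 1) ?_
    have := gegenbauer_succ_succ (ν + 1) s ρ k
    simp only [map_add, map_one] at this
    push_cast
    linear_combination (k + 2 + algebraMap ℝ A ν) * hk - algebraMap ℝ A ν * this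
  induction k using Nat.twoStepInduction with
  | zero =>
    constructor <;> simp [gegenbauer_zero, gegenbauer_one] <;> ring
  | one =>
    have h : ((0 : ℕ) + 2 : A) * gegenbauer ν s ρ (0 + 2) =
      2 * algebraMap ℝ A ν * (s * gegenbauer (ν + 1) s ρ (0 + 1) -
        ρ * gegenbauer (ν + 1) s ρ 0) := by
      rw [gegenbauer_succ_succ]
      simp only [gegenbauer_zero, gegenbauer_one, map_add, map_one, zero_add]
      push_cast; ring
    have h' := key 0 h
    norm_num at h h' ⊢
    constructor
    · linear_combination h
    · linear_combination h'
  | more k e0 e1 =>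
    have h : ((k + 1 : ℕ) + 2 : A) * gegenbauer ν s ρ (k + 1 + 2) =
      2 * algebraMap ℝ A ν * (s * gegenbauer (ν + 1) s ρ (k + 1 + 1) -
        ρ * gegenbauer (ν + 1) s ρ (k + 1)) := by
      rw [gegenbauer_succ_succ]
      have e1' := e1.2
      simp only [Nat.succ_ne_zero, if_false, Nat.add_sub_cancel] at e1'
      push_cast at e1' ⊢
      linear_combination 2 * s * e1' - 2 * ρ * e0.2 + ρ * e0.1
    have h' := key (k + 1) h
    simp only [Nat.succ_ne_zero, if_false, show k + 2 - 1 = k + 1 by omega]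
    push_cast at h h' ⊢
    constructor
    · linear_combination h
    · linear_combination h'

theorem gegenbauer_mul_succ_succ (ν : ℝ) (s ρ : A) (k : ℕ) :
    (k + 2 + algebraMap ℝ A ν) * gegenbauer ν s ρ (k + 2) =
      algebraMap ℝ A ν * (gegenbauer (ν + 1) s ρ (k + 2) - ρ * gegenbauer (ν + 1) s ρ k) := by
  have := (gegenbauer_mul_succ ν s ρ (k + 1)).2
  simp only [Nat.succ_ne_zero, if_false, Nat.add_sub_cancel] at this
  push_cast at this
  linear_combination this

/-- Coefficient form of wG_ν' + 2νG_ν = 2ν(1 - sw)G_{ν+1}. -/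
theorem gegenbauer_add_mul_succ (ν : ℝ) (s ρ : A) (k : ℕ) :
    (k + 1 + 2 * algebraMap ℝ A ν) * gegenbauer ν s ρ (k + 1) =
      2 * algebraMap ℝ A ν * (gegenbauer (ν + 1) s ρ (k + 1) -
        s * gegenbauer (ν + 1) s ρ k) := by
  obtain ⟨h1, h2⟩ := gegenbauer_mul_succ ν s ρ k
  linear_combination 2 * h2 - h1

/-- The chain rule δG_ν = ν(2w δs - w² δρ)G_{ν+1}, read off coefficientwise; working with the
recurrence avoids formal power series over A. -/
theorem derivation_gegenbauer (δ : Derivation ℝ A A) (ν : ℝ) (s ρ : A) (k : ℕ) :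
    δ (gegenbauer ν s ρ (k + 1)) = algebraMap ℝ A ν * (2 * δ s * gegenbauer (ν + 1) s ρ k -
      if k = 0 then 0 else δ ρ * gegenbauer (ν + 1) s ρ (k - 1)) := by
  have hrec : ∀ k : ℕ, ((k : A) + 2) * δ (gegenbauer ν s ρ (k + 2)) =
      2 * (k + 1 + algebraMap ℝ A ν) * (s * δ (gegenbauer ν s ρ (k + 1)) +
        δ s * gegenbauer ν s ρ (k + 1)) -
        (k + 2 * algebraMap ℝ A ν) * (ρ * δ (gegenbauer ν s ρ k) + δ ρ * gegenbauer ν s ρ k) := by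
    intro k
    have h := congrArg δ (gegenbauer_succ_succ ν s ρ k)
    have hc : ((k : A) + 2) = algebraMap ℝ A (k + 2) := by simp [algebraMap_real_two]
    have hc1 : 2 * (k + 1 + algebraMap ℝ A ν) = algebraMap ℝ A (2 * (k + 1 + ν)) := by
      simp [algebraMap_real_two]
    have hc2 : (k + 2 * algebraMap ℝ A ν) = algebraMap ℝ A (k + 2 * ν) := by
      simp [algebraMap_real_two]
    rw [hc, hc1, hc2] at h ⊢
    simp only [map_sub, mul_assoc, Derivation.leibniz, Derivation.map_algebraMap, smul_eq_mul,
      mul_zero, add_zero] at h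
    rw [h]; ring
  induction k using Nat.twoStepInduction with
  | zero =>
    simp only [gegenbauer_zero, gegenbauer_one, zero_add, if_true]
    have hc1 : 2 * algebraMap ℝ A ν = algebraMap ℝ A (2 * ν) := by simp [algebraMap_real_two]
    rw [hc1, Derivation.leibniz, Derivation.map_algebraMap]
    simp [algebraMap_real_two]; ring
  | one =>
    have := hrec 0
    refine natCast_add_one_mul_cancel (k := 1) ?_
    simp only [gegenbauer_zero, gegenbauer_one, zero_add, Derivation.map_one_eq_zero] at this ⊢
    have hc1 : 2 * algebraMap ℝ A ν = algebraMap ℝ A (2 * ν) := by simp [algebraMap_real_two]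
    rw [hc1, Derivation.leibniz, Derivation.map_algebraMap] at this
    simp only [smul_eq_mul, map_mul, map_add, map_one, algebraMap_real_two] at this ⊢
    norm_num [gegenbauer_zero, gegenbauer_one] at this ⊢
    linear_combination this
  | more k e0 e1 =>
    have h := hrec (k + 1)
    rw [e1, e0] at h
    simp only [Nat.succ_ne_zero, if_false, Nat.add_sub_cancel,
      show k + 2 - 1 = k + 1 by omega] at h e0 e1 ⊢
    refine natCast_add_one_mul_cancel (k := k + 2) ?_
    have h1 := gegenbauer_mul_succ_succ ν s ρ k
    have h2 := gegenbauer_add_mul_succ ν s ρ k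
    have h3 := gegenbauer_succ_succ (ν + 1) s ρ k
    have h4 : k ≠ 0 → ((k : A) + 1) * gegenbauer (ν + 1) s ρ (k + 1) =
      2 * (k + 1 + algebraMap ℝ A ν) * s * gegenbauer (ν + 1) s ρ k -
        (k + 1 + 2 * algebraMap ℝ A ν) * ρ * gegenbauer (ν + 1) s ρ (k - 1) := by
      rcases k with _ | k
      · simp
      · intro _
        have := gegenbauer_succ_succ (ν + 1) s ρ k
        simp only [map_add, map_one, Nat.add_sub_cancel] at this ⊢
        push_cast
        linear_combination this
    simp only [map_add, map_one] at h3
    push_cast at h ⊢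
    have e : (k : A) + 1 + 2 = k + 2 + 1 := by ring
    rw [e] at h
    rw [h]
    rcases Nat.eq_zero_or_pos k with rfl | hk
    · have h5 := gegenbauer_one (ν + 1) s ρ
      simp only [map_add, map_one] at h5
      simp only [gegenbauer_zero, if_true] at h1 h2 h3 ⊢
      norm_num at h1 h2 h3 ⊢
      linear_combination 2 * δ s * h1 - 2 * algebraMap ℝ A ν * δ s * h3 - δ ρ * h2
        + algebraMap ℝ A ν * δ ρ * h5
    · rw [if_neg hk.ne']
      linear_combination 2 * δ s * h1 - 2 * algebraMap ℝ A ν * δ s * h3 - δ ρ * h2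
        + algebraMap ℝ A ν * δ ρ * h4 hk.ne'

end Gegenbauer

/-! ### Zonal harmonic polynomials -/

section Zonal

open MvPolynomial

variable {A B : Type*} [CommRing A] [Algebra ℝ A] [CommRing B] [Algebra ℝ B]

/-- The coefficients of `(1 - ρ w²) (1 - 2 s w + ρ w²) ^ (-ν)` as a power series in `w`. -/
def zonalSeq (ν : ℝ) (s ρ : A) : ℕ → A
  | 0 => 1
  | 1 => gegenbauer ν s ρ 1
  | k + 2 => gegenbauer ν s ρ (k + 2) - ρ * gegenbauer ν s ρ k

theorem map_zonalSeq (f : A →ₐ[ℝ] B) (ν : ℝ) (s ρ : A) (k : ℕ) :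
    f (zonalSeq ν s ρ k) = zonalSeq ν (f s) (f ρ) k := by
  rcases k with _ | _ | k <;> simp [zonalSeq, map_gegenbauer]

/-- The linear form `⟨y, ·⟩` as a polynomial. -/
def linearFormPoly {n : ℕ} (y : EucSpace n) : MvPolynomial (Fin n) ℝ :=
  ∑ i, C (y i) * X i

/-- The square of the Euclidean norm as a polynomial. -/
def normSqPoly (n : ℕ) : MvPolynomial (Fin n) ℝ := ∑ i, X i ^ 2

variable {n : ℕ}

theorem eval_linearFormPoly (y x : EucSpace n) :
    eval (fun i => x i) (linearFormPoly y) = ⟪y, x⟫_ℝ := by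
  simp [linearFormPoly, PiLp.inner_apply, mul_comm]

theorem eval_normSqPoly (x : EucSpace n) :
    eval (fun i => x i) (normSqPoly n) = ‖x‖ ^ 2 := by
  simp [normSqPoly, EuclideanSpace.norm_sq_eq]

theorem isHomogeneous_linearFormPoly (y : EucSpace n) : (linearFormPoly y).IsHomogeneous 1 :=
  IsHomogeneous.sum _ _ _ fun i _ => by
    simpa using (isHomogeneous_C _ _).mul (isHomogeneous_X ℝ i)

theorem isHomogeneous_normSqPoly : (normSqPoly n).IsHomogeneous 2 :=
  IsHomogeneous.sum _ _ _ fun i _ => by simpa using (isHomogeneous_X ℝ i).pow 2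

theorem pderiv_linearFormPoly (y : EucSpace n) (i : Fin n) :
    pderiv i (linearFormPoly y) = C (y i) := by
  classical
  simp [linearFormPoly, Derivation.leibniz, pderiv_X, Pi.single_apply]

theorem pderiv_normSqPoly (i : Fin n) : pderiv i (normSqPoly n) = 2 * X i := by
  classical
  simp [normSqPoly, Derivation.leibniz_pow, pderiv_X, Pi.single_apply]

theorem polyLaplacian_apply (f : MvPolynomial (Fin n) ℝ) :
    polyLaplacian n f = ∑ i, pderiv i (pderiv i f) := by
  simp [polyLaplacian]

theorem isHomogeneous_gegenbauer {ν : ℝ} {s ρ : MvPolynomial (Fin n) ℝ}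
    (hs : s.IsHomogeneous 1) (hρ : ρ.IsHomogeneous 2) (k : ℕ) :
    (gegenbauer ν s ρ k).IsHomogeneous k := by
  induction k using Nat.twoStepInduction with
  | zero => rw [gegenbauer_zero]; exact isHomogeneous_one _ _
  | one =>
    rw [gegenbauer, smul_eq_C_mul]
    exact hs.C_mul _
  | more k h0 h1 =>
    rw [gegenbauer]
    have e1 := hs.mul h1
    have e2 := hρ.mul h0
    rw [show 1 + (k + 1) = k + 2 by omega] at e1
    rw [show 2 + k = k + 2 by omega] at e2
    rw [smul_eq_C_mul, smul_eq_C_mul, smul_eq_C_mul]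
    exact ((e1.C_mul _).sub (e2.C_mul _)).C_mul _

theorem isHomogeneous_zonalSeq {ν : ℝ} {s ρ : MvPolynomial (Fin n) ℝ}
    (hs : s.IsHomogeneous 1) (hρ : ρ.IsHomogeneous 2) (k : ℕ) :
    (zonalSeq ν s ρ k).IsHomogeneous k := by
  rcases k with _ | _ | k
  · exact isHomogeneous_one _ _
  · exact isHomogeneous_gegenbauer hs hρ 1
  · have e2 := hρ.mul (isHomogeneous_gegenbauer (ν := ν) hs hρ k)
    rw [show 2 + k = k + 2 by omega] at e2
    exact (isHomogeneous_gegenbauer hs hρ _).sub e2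

/-- The derivative along y sends s to |y|² = 1 and ρ to 2s; the chain rule then gives exactly the
combination in `gegenbauer_add_mul_succ`. -/
theorem sum_mul_pderiv_gegenbauer (ν : ℝ) {y : EucSpace n} (hy : ‖y‖ = 1) (k : ℕ) :
    ∑ i, C (y i) * pderiv i (gegenbauer ν (linearFormPoly y) (normSqPoly n) (k + 1)) =
      ((k : MvPolynomial (Fin n) ℝ) + 2 * C ν) * gegenbauer ν (linearFormPoly y) (normSqPoly n) k := by
  set s := linearFormPoly y with hs
  set ρ := normSqPoly n with hρ
  let D : Derivation ℝ (MvPolynomial (Fin n) ℝ) (MvPolynomial (Fin n) ℝ) :=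
    ∑ i, (C (y i) : MvPolynomial (Fin n) ℝ) •
      (pderiv i : Derivation ℝ (MvPolynomial (Fin n) ℝ) (MvPolynomial (Fin n) ℝ))
  have hD : ∀ f, D f = ∑ i, C (y i) * pderiv i f := fun f => by
    simp only [D, ← Derivation.coeFnAddMonoidHom_apply, map_sum, Finset.sum_apply]
    simp
  have hDs : D s = 1 := by
    rw [hD]
    simp only [hs, pderiv_linearFormPoly]
    have : ∑ i, y i * y i = 1 := by
      have := EuclideanSpace.norm_sq_eq y
      simp only [hy, Real.norm_eq_abs, sq_abs] at this
      simp only [← pow_two]; rw [← this]; norm_num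
    rw [← map_one C, ← this, map_sum]
    simp
  have hDρ : D ρ = 2 * s := by
    rw [hD]
    simp only [hρ, pderiv_normSqPoly, hs, linearFormPoly, Finset.mul_sum]
    exact Finset.sum_congr rfl fun i _ => by ring
  rw [← hD, derivation_gegenbauer, hDs, hDρ]
  rcases k with _ | k
  · simp [gegenbauer_zero, algebraMap_eq]; ring
  · have := gegenbauer_add_mul_succ ν s ρ k
    simp only [algebraMap_eq, Nat.succ_ne_zero, if_false, Nat.add_sub_cancel] at this ⊢
    push_cast
    linear_combination -this

/-- Since |y| = 1, the generating function is |wx - y|^(-n), and this is the identity Δ|x|^(-n) =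
2n|x|^(-n-2) with x replaced by wx - y. -/
theorem polyLaplacian_gegenbauer {y : EucSpace n} (hy : ‖y‖ = 1) (k : ℕ) :
    polyLaplacian n (gegenbauer (n / 2) (linearFormPoly y) (normSqPoly n) (k + 2)) =
      2 * n * gegenbauer (n / 2 + 1) (linearFormPoly y) (normSqPoly n) k := by
  set s := linearFormPoly y with hs
  set ρ := normSqPoly n with hρ
  have ha : 2 * C (σ := Fin n) ((n : ℝ) / 2) = (n : MvPolynomial (Fin n) ℝ) := by
    rw [← map_ofNat C, ← C_mul, ← map_natCast C]; congr 1; ring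
  have h1 : ∀ i, pderiv i (gegenbauer (n / 2) s ρ (k + 2)) =
      (n : MvPolynomial (Fin n) ℝ) * (C (y i) * gegenbauer (n / 2 + 1) s ρ (k + 1) -
        X i * gegenbauer (n / 2 + 1) s ρ k) := fun i => by
    rw [derivation_gegenbauer, ← ha]
    simp only [hs, hρ, pderiv_linearFormPoly, pderiv_normSqPoly, algebraMap_eq,
      Nat.succ_ne_zero, if_false, Nat.add_sub_cancel]
    ring
  have h2 : ∀ i, pderiv i (pderiv i (gegenbauer (n / 2) s ρ (k + 2))) =
      (n : MvPolynomial (Fin n) ℝ) *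
        (C (y i) * pderiv i (gegenbauer (n / 2 + 1) s ρ (k + 1)) -
        X i * pderiv i (gegenbauer (n / 2 + 1) s ρ k) - gegenbauer (n / 2 + 1) s ρ k) :=
      fun i => by
    rw [h1]
    simp only [Derivation.leibniz, map_sub, pderiv_C, pderiv_X_self, smul_eq_mul,
      Derivation.map_natCast]
    ring
  rw [polyLaplacian_apply]
  simp only [h2, ← Finset.mul_sum, Finset.sum_sub_distrib]
  rw [sum_mul_pderiv_gegenbauer _ hy, (isHomogeneous_gegenbauer (isHomogeneous_linearFormPoly y)
    isHomogeneous_normSqPoly k).sum_X_mul_pderiv]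
  simp only [nsmul_eq_mul, Finset.sum_const, Finset.card_univ, Fintype.card_fin, map_add, map_one]
  linear_combination (n : MvPolynomial (Fin n) ℝ) * gegenbauer (n / 2 + 1) s ρ k * ha

/-- Leibniz rule with Δ|x|² = 2n and ∇|x|² = 2x; the cross term is evaluated by Euler's identity. -/
theorem polyLaplacian_normSqPoly_mul {f : MvPolynomial (Fin n) ℝ} {k : ℕ}
    (hf : f.IsHomogeneous k) :
    polyLaplacian n (normSqPoly n * f) =
      (2 * n + 4 * k) * f + normSqPoly n * polyLaplacian n f := by
  have h2 : ∀ i, pderiv i (pderiv i (normSqPoly n * f)) =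
      2 * f + 4 * (X i * pderiv i f) + normSqPoly n * pderiv i (pderiv i f) := fun i => by
    have : pderiv i (2 : MvPolynomial (Fin n) ℝ) = 0 := by
      rw [← map_ofNat C, pderiv_C]
    simp only [Derivation.leibniz, map_add, pderiv_normSqPoly, pderiv_X_self, smul_eq_mul, this]
    ring
  rw [polyLaplacian_apply, polyLaplacian_apply]
  simp only [h2, Finset.sum_add_distrib, ← Finset.mul_sum, hf.sum_X_mul_pderiv]
  simp only [nsmul_eq_mul, Finset.sum_const, Finset.card_univ, Fintype.card_fin]
  ring

/-- Harmonicity of the Poisson kernel, degree by degree. In high degree the terms cancel by the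
identity (k + ν)c_k = ν(c_k⁺ - ρc_{k-2}⁺) with ν = n/2, where ⁺ denotes exponent ν + 1; low degrees
are treated separately. -/
theorem polyLaplacian_zonalSeq {y : EucSpace n} (hy : ‖y‖ = 1) (k : ℕ) :
    polyLaplacian n (zonalSeq (n / 2) (linearFormPoly y) (normSqPoly n) k) = 0 := by
  have ha : 2 * C (σ := Fin n) ((n : ℝ) / 2) = (n : MvPolynomial (Fin n) ℝ) := by
    rw [← map_ofNat C, ← C_mul, ← map_natCast C]; congr 1; ring
  have h1 : polyLaplacian n
      (gegenbauer (n / 2) (linearFormPoly y) (normSqPoly n) 1) = 0 := by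
    rw [polyLaplacian_apply, gegenbauer_one]
    refine Finset.sum_eq_zero fun i _ => ?_
    rw [algebraMap_eq, ha, ← map_natCast C]
    simp [Derivation.leibniz, pderiv_linearFormPoly]
  rcases k with _ | _ | k
  · rw [polyLaplacian_apply]; simp [zonalSeq]
  · exact h1
  · rw [zonalSeq, map_sub, polyLaplacian_gegenbauer hy, polyLaplacian_normSqPoly_mul
      (isHomogeneous_gegenbauer (isHomogeneous_linearFormPoly y) isHomogeneous_normSqPoly k)]
    rcases k with _ | _ | k
    · rw [polyLaplacian_apply]; simp [gegenbauer_zero]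
    · rw [h1, gegenbauer_one, gegenbauer_one, map_add, map_one, algebraMap_eq, ← ha]
      push_cast
      ring
    · rw [polyLaplacian_gegenbauer hy]
      have := gegenbauer_mul_succ_succ (n / 2) (linearFormPoly y) (normSqPoly n) k
      rw [algebraMap_eq] at this
      push_cast
      rw [← ha]
      linear_combination -4 * this

/-- The zonal harmonic of degree `k` with pole `y`. -/
def zonalHarmonic {y : EucSpace n} (hy : ‖y‖ = 1) (k : ℕ) : harmonicSpace n k :=
  ⟨zonalSeq (n / 2) (linearFormPoly y) (normSqPoly n) k,
    isHomogeneous_zonalSeq (isHomogeneous_linearFormPoly y) isHomogeneous_normSqPoly k,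
    polyLaplacian_zonalSeq hy k⟩

theorem harmonicEval_zonalHarmonic {y : EucSpace n} (hy : ‖y‖ = 1) (k : ℕ) (x : EucSpace n) :
    harmonicEval (zonalHarmonic hy k) x = zonalSeq (n / 2) ⟪y, x⟫_ℝ (‖x‖ ^ 2) k := by
  have h : ∀ f : MvPolynomial (Fin n) ℝ, eval (fun i => x i) f = aeval (fun i => x i) f :=
    fun f => by rw [← coe_aeval_eq_eval]; rfl
  unfold harmonicEval zonalHarmonic
  rw [h, map_zonalSeq, ← h, ← h, eval_linearFormPoly, eval_normSqPoly]

/-- The product `n (n + 2) ⋯ (n + 2 k - 2)`. -/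
def radialMoment (n k : ℕ) : ℝ := ∏ j ∈ Finset.range k, ((n : ℝ) + 2 * j)

/-- Modulo multiples of the squared norm, a Gegenbauer polynomial is a power of a linear form. -/
theorem exists_gegenbauer_eq (y : EucSpace n) (k : ℕ) :
    ∃ q : MvPolynomial (Fin n) ℝ, q.IsHomogeneous (k - 2) ∧ (k < 2 → q = 0) ∧
      gegenbauer (n / 2) (linearFormPoly y) (normSqPoly n) k =
        C (radialMoment n k / k.factorial) * linearFormPoly y ^ k + normSqPoly n * q := by
  have ha : 2 * C (σ := Fin n) ((n : ℝ) / 2) = (n : MvPolynomial (Fin n) ℝ) := by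
    rw [← map_ofNat C, ← C_mul, ← map_natCast C]; congr 1; ring
  induction k using Nat.twoStepInduction with
  | zero =>
    exact ⟨0, isHomogeneous_zero _ _ _, fun _ => rfl, by simp [gegenbauer_zero, radialMoment]⟩
  | one =>
    refine ⟨0, isHomogeneous_zero _ _ _, fun _ => rfl, ?_⟩
    rw [gegenbauer_one, algebraMap_eq, ha]
    simp [radialMoment]
  | more k _ h1 =>
    obtain ⟨q, hq, hq0, h1⟩ := h1
    have hc : C (σ := Fin n) (((k : ℝ) + 2)⁻¹) * ((k : MvPolynomial (Fin n) ℝ) + 2) = 1 := by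
      have : ((k : MvPolynomial (Fin n) ℝ) + 2) = C ((k : ℝ) + 2) := by
        rw [C_add, map_natCast, map_ofNat]
      rw [this, ← C_mul, inv_mul_cancel₀ (by positivity), C_1]
    -- Insert the decomposition of degree k + 1 into the recurrence; the degree k term already
    -- carries the factor |x|², so it goes wholly into the quotient.
    refine ⟨C (((k : ℝ) + 2)⁻¹) * (2 * (C ((k : ℝ) + 1 + n / 2)) * linearFormPoly y * q -
      C ((k : ℝ) + n) * gegenbauer (n / 2) (linearFormPoly y) (normSqPoly n) k), ?_, ?_, ?_⟩
    · have h3 := isHomogeneous_gegenbauer (ν := n / 2) (isHomogeneous_linearFormPoly y)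
        isHomogeneous_normSqPoly k
      have h4 : (2 * (C ((k : ℝ) + 1 + n / 2)) * linearFormPoly y * q).IsHomogeneous k := by
        -- For k = 0 the truncated degree of q is 0 instead of -1, so the degree count would fail;
        -- the clause forcing q = 0 is there for this case.
        rcases k with _ | k
        · rw [hq0 (by omega), mul_zero]; exact isHomogeneous_zero _ _ _
        · have := ((isHomogeneous_C (Fin n) (2 * ((k + 1 : ℕ) + 1 + (n : ℝ) / 2))).mul
            (isHomogeneous_linearFormPoly y)).mul hq
          rw [C_mul, map_ofNat] at this
          convert this using 1
          omega
      have h5 := (isHomogeneous_C (Fin n) (((k : ℝ) + 2)⁻¹)).mul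
        (h4.sub (by simpa using (isHomogeneous_C (Fin n) ((k : ℝ) + n)).mul h3))
      simpa using h5
    · omega
    · have h3 := gegenbauer_succ_succ (n / 2) (linearFormPoly y) (normSqPoly n) k
      have h4 : radialMoment n (k + 2) / (k + 2).factorial =
          ((k : ℝ) + 2)⁻¹ * (2 * (k + 1) + n) * (radialMoment n (k + 1) / (k + 1).factorial) := by
        rw [radialMoment, Finset.prod_range_succ, ← radialMoment, Nat.factorial_succ]
        have : ((k + 1).factorial : ℝ) ≠ 0 := by positivity
        push_cast
        field_simp
        ring
      rw [h1] at h3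
      rw [h4]
      simp only [C_mul, C_add, map_natCast, map_ofNat, map_one, algebraMap_eq] at h3 hc ⊢
      rw [← ha] at *
      linear_combination (C (((k : ℝ) + 2)⁻¹)) * h3 -
        gegenbauer (n / 2) (linearFormPoly y) (normSqPoly n) (k + 2) * hc

theorem exists_zonalHarmonic_eq {y : EucSpace n} (hy : ‖y‖ = 1) (k : ℕ) :
    ∃ q : MvPolynomial (Fin n) ℝ, q.IsHomogeneous (k - 2) ∧ (k < 2 → q = 0) ∧
      (zonalHarmonic hy k : MvPolynomial (Fin n) ℝ) =
        C (radialMoment n k / k.factorial) * linearFormPoly y ^ k + normSqPoly n * q := by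
  obtain ⟨q, hq, hq0, h⟩ := exists_gegenbauer_eq y k
  rcases k with _ | _ | k
  · exact ⟨q, hq, hq0, by rw [← h]; simp [zonalHarmonic, zonalSeq, gegenbauer_zero]⟩
  · exact ⟨q, hq, hq0, by rw [← h]; simp [zonalHarmonic, zonalSeq]⟩
  · refine ⟨q - gegenbauer (n / 2) (linearFormPoly y) (normSqPoly n) k, hq.sub
      (isHomogeneous_gegenbauer (isHomogeneous_linearFormPoly y) isHomogeneous_normSqPoly k),
      by omega, ?_⟩
    simp only [zonalHarmonic, zonalSeq, h]
    ring

end Zonal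

/-! ### Functionals satisfying the Gaussian integration by parts formula -/

section IntegrationByParts

open MvPolynomial

variable {n : ℕ}

theorem pderiv_commute (i j : Fin n) (f : MvPolynomial (Fin n) ℝ) :
    pderiv i (pderiv j f) = pderiv j (pderiv i f) := by
  classical
  have h : ⁅(pderiv i : Derivation ℝ (MvPolynomial (Fin n) ℝ) (MvPolynomial (Fin n) ℝ)),
      pderiv j⁆ = 0 :=
    derivation_ext fun k => by
      rw [Derivation.commutator_apply, pderiv_X, pderiv_X, Pi.single_apply, Pi.single_apply]
      split_ifs <;> simp
  have := congrArg (fun D => D f) h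
  simpa [Derivation.commutator_apply, sub_eq_zero] using this

theorem polyLaplacian_pderiv (i : Fin n) (f : MvPolynomial (Fin n) ℝ) :
    polyLaplacian n (pderiv i f) = pderiv i (polyLaplacian n f) := by
  simp only [polyLaplacian_apply, map_sum]
  exact Finset.sum_congr rfl fun j _ => by rw [pderiv_commute j i, pderiv_commute j i]

variable {E : MvPolynomial (Fin n) ℝ →ₗ[ℝ] ℝ}

/-- Euler's identity writes kp as ∑ xᵢ∂ᵢp; integrating each xᵢ by parts leaves the gradient pairing
plus g Δp, which vanishes. -/
theorem natCast_mul_functional_mul (hE : ∀ i f, E (X i * f) = E (pderiv i f))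
    {p : MvPolynomial (Fin n) ℝ} {k : ℕ} (hp : p.IsHomogeneous k) (hΔ : polyLaplacian n p = 0)
    (g : MvPolynomial (Fin n) ℝ) : k * E (g * p) = ∑ i, E (pderiv i g * pderiv i p) := by
  have h1 : (k : ℝ) * E (g * p) = E (g * (k • p)) := by
    rw [mul_smul_comm, map_nsmul, nsmul_eq_mul]
  have h2 : ∀ i, g * (X i * pderiv i p) = X i * (g * pderiv i p) := fun i => by ring
  rw [h1, ← hp.sum_X_mul_pderiv, Finset.mul_sum, map_sum]
  simp only [h2, hE, Derivation.leibniz, smul_eq_mul, map_add, Finset.sum_add_distrib]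
  rw [← map_sum, ← Finset.mul_sum, ← polyLaplacian_apply, hΔ, mul_zero, map_zero, zero_add]
  exact Finset.sum_congr rfl fun i _ => by rw [mul_comm]

/-- Passing to the gradient pairing lowers both degrees by one and keeps the second factor harmonic;
when g becomes constant the pairing is zero. -/
theorem functional_mul_eq_zero (hE : ∀ i f, E (X i * f) = E (pderiv i f)) {j : ℕ} :
    ∀ {k : ℕ} {g p : MvPolynomial (Fin n) ℝ}, j < k → g.IsHomogeneous j → p.IsHomogeneous k →
      polyLaplacian n p = 0 → E (g * p) = 0 := by
  induction j with
  | zero =>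
    intro k g p hk hg hp hΔ
    rw [← totalDegree_zero_iff_isHomogeneous, totalDegree_eq_zero_iff_eq_C] at hg
    have := natCast_mul_functional_mul hE hp hΔ g
    rw [hg] at this ⊢
    simp only [pderiv_C, zero_mul, map_zero, Finset.sum_const_zero] at this
    exact (mul_eq_zero.1 this).resolve_left (by exact_mod_cast hk.ne')
  | succ j ih =>
    intro k g p hk hg hp hΔ
    have := natCast_mul_functional_mul hE hp hΔ g
    rw [Finset.sum_eq_zero fun i _ => ih (k := k - 1) (by omega) hg.pderiv hp.pderiv
      (by rw [polyLaplacian_pderiv, hΔ, map_zero])] at this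
    exact (mul_eq_zero.1 this).resolve_left (by exact_mod_cast (by omega : k ≠ 0))

/-- The gradient of ⟨y,·⟩^(k+1) is (k+1)⟨y,·⟩ᵏ y, so induction applies to each ∂ᵢp and Euler's
identity at y reassembles p(y). -/
theorem functional_linearFormPoly_pow_mul (hE : ∀ i f, E (X i * f) = E (pderiv i f))
    (y : EucSpace n) {k : ℕ} : ∀ {p : MvPolynomial (Fin n) ℝ}, p.IsHomogeneous k →
      polyLaplacian n p = 0 →
      E (linearFormPoly y ^ k * p) = k.factorial * eval (fun i => y i) p * E 1 := by
  induction k with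
  | zero =>
    intro p hp _
    rw [← totalDegree_zero_iff_isHomogeneous, totalDegree_eq_zero_iff_eq_C] at hp
    have h : p = coeff 0 p • 1 := by rw [smul_eq_C_mul, mul_one]; exact hp
    rw [h]
    simp
  | succ k ih =>
    intro p hp hΔ
    have h1 := natCast_mul_functional_mul hE hp hΔ (linearFormPoly y ^ (k + 1))
    have h2 : ∀ i, E (pderiv i (linearFormPoly y ^ (k + 1)) * pderiv i p) =
        (k + 1) * k.factorial * E 1 * eval (fun i => y i) (X i * pderiv i p) := fun i => by
      have h3 : pderiv i (linearFormPoly y ^ (k + 1)) * pderiv i p =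
          ((k + 1) * y i) • (linearFormPoly y ^ k * pderiv i p) := by
        rw [Derivation.leibniz_pow, pderiv_linearFormPoly, smul_eq_C_mul]
        simp
        ring
      rw [h3, map_smul, ih hp.pderiv (by rw [polyLaplacian_pderiv, hΔ, map_zero])]
      simp
      ring
    simp only [h2, ← Finset.mul_sum, ← map_sum, hp.sum_X_mul_pderiv] at h1
    have h4 : ((k : ℝ) + 1) ≠ 0 := by positivity
    rw [map_nsmul, nsmul_eq_mul] at h1
    push_cast [Nat.factorial_succ] at h1 ⊢
    refine mul_left_cancel₀ h4 (h1.trans ?_)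
    ring

theorem functional_normSqPoly_mul (hE : ∀ i f, E (X i * f) = E (pderiv i f))
    {f : MvPolynomial (Fin n) ℝ} {k : ℕ} (hf : f.IsHomogeneous k) :
    E (normSqPoly n * f) = (n + k) * E f := by
  have h : ∀ i, E (X i ^ 2 * f) = E f + E (X i * pderiv i f) := fun i => by
    rw [pow_two, mul_assoc, hE, Derivation.leibniz, pderiv_X_self, map_add]
    simp [add_comm]
  rw [normSqPoly, Finset.sum_mul, map_sum]
  simp only [h, Finset.sum_add_distrib]
  rw [← map_sum E (fun i => X i * pderiv i f), hf.sum_X_mul_pderiv, map_nsmul]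
  simp
  ring

theorem functional_normSqPoly_pow (hE : ∀ i f, E (X i * f) = E (pderiv i f)) (k : ℕ) :
    E (normSqPoly n ^ k) = radialMoment n k * E 1 := by
  induction k with
  | zero => simp [radialMoment]
  | succ k ih =>
    rw [pow_succ', functional_normSqPoly_mul hE (isHomogeneous_normSqPoly.pow k), ih,
      radialMoment, radialMoment, Finset.prod_range_succ]
    push_cast
    ring

/-- Only the leading power of the linear form contributes: the remainder |x|²q pairs with p as a
multiple of E(qp), which is zero because q has smaller degree. -/
theorem functional_zonalHarmonic_mul (hE : ∀ i f, E (X i * f) = E (pderiv i f))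
    {y : EucSpace n} (hy : ‖y‖ = 1) {k : ℕ} (p : harmonicSpace n k) :
    E ((zonalHarmonic hy k : MvPolynomial (Fin n) ℝ) * p) =
      radialMoment n k * harmonicEval p y * E 1 := by
  obtain ⟨p, hp, hΔ⟩ := p
  have hp' : p.IsHomogeneous k := hp
  have hΔ' : polyLaplacian n p = 0 := hΔ
  obtain ⟨q, hq, hq0, h⟩ := exists_zonalHarmonic_eq hy k
  have hz : E (normSqPoly n * (q * p)) = 0 := by
    rw [functional_normSqPoly_mul hE (hq.mul hp')]
    rcases lt_or_ge k 2 with h2 | h2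
    · simp [hq0 h2]
    · rw [functional_mul_eq_zero hE (by omega : k - 2 < k) hq hp' hΔ', mul_zero]
  have h1 : (zonalHarmonic hy k : MvPolynomial (Fin n) ℝ) * p =
      (radialMoment n k / k.factorial) • (linearFormPoly y ^ k * p) +
        normSqPoly n * (q * p) := by
    rw [h, smul_eq_C_mul]; ring
  rw [h1, map_add, hz, map_smul, functional_linearFormPoly_pow_mul hE y hp' hΔ', harmonicEval]
  have : (k.factorial : ℝ) ≠ 0 := by positivity
  simp only [smul_eq_mul]
  field_simp
  ring

end IntegrationByParts

/-! ### The Gaussian functional and averages over the sphere -/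

section Gaussian

open MvPolynomial

variable {n : ℕ}

theorem continuous_eval_euc (f : MvPolynomial (Fin n) ℝ) :
    Continuous fun x : EucSpace n => eval (fun i => x i) f :=
  (MvPolynomial.continuous_eval _).comp (by fun_prop)

theorem hasLineDerivAt_eval (f : MvPolynomial (Fin n) ℝ) (i : Fin n) (x : EucSpace n) :
    HasLineDerivAt ℝ (fun x : EucSpace n => eval (fun i => x i) f)
      (eval (fun i => x i) (pderiv i f)) x (EuclideanSpace.single i 1) := by
  unfold HasLineDerivAt
  induction f using MvPolynomial.induction_on with
  | C a => simpa using hasDerivAt_const (0 : ℝ) a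
  | add p q hp hq =>
    exact ((hp.add hq).congr_deriv (by simp)).congr_of_eventuallyEq
      (Filter.Eventually.of_forall fun t => by simp)
  | mul_X p j hp =>
    have hX : HasDerivAt (fun t : ℝ => (x + t • EuclideanSpace.single i (1 : ℝ)) j)
        (eval (fun i => x i) (pderiv i (X j))) 0 := by
      classical
      have h := (hasDerivAt_mul_const (x := (0 : ℝ)) (if j = i then (1 : ℝ) else 0)).const_add (x j)
      refine (h.congr_deriv ?_).congr_of_eventuallyEq (Filter.Eventually.of_forall fun t => ?_)
      · rw [pderiv_X, Pi.single_apply]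
        split_ifs <;> simp_all
      · simp
    refine ((hp.mul hX).congr_deriv ?_).congr_of_eventuallyEq
      (Filter.Eventually.of_forall fun t => by simp)
    rw [Derivation.leibniz]
    simp only [smul_eq_mul, map_add, map_mul, zero_smul, add_zero, eval_X]
    ring

theorem hasLineDerivAt_gaussian (i : Fin n) (x : EucSpace n) :
    HasLineDerivAt ℝ (fun x : EucSpace n => Real.exp (-‖x‖ ^ 2 / 2))
      (-(x i) * Real.exp (-‖x‖ ^ 2 / 2)) x (EuclideanSpace.single i 1) := by
  have h := (hasLineDerivAt_eval (normSqPoly n) i x)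
  simp only [eval_normSqPoly, pderiv_normSqPoly] at h
  unfold HasLineDerivAt at h ⊢
  refine (h.neg.div_const 2).exp.congr_deriv ?_
  simp
  ring

variable (n) in
theorem integrable_norm_pow_mul_gaussian [NeZero n] (d : ℕ) :
    Integrable fun x : EucSpace n => ‖x‖ ^ d * Real.exp (-‖x‖ ^ 2 / 2) := by
  have : Nontrivial (EucSpace n) :=
    Module.nontrivial_of_finrank_pos (R := ℝ) (by simp [Nat.pos_of_ne_zero (NeZero.ne n)])
  rw [integrable_fun_norm_addHaar volume (f := fun r : ℝ => r ^ d * Real.exp (-r ^ 2 / 2))]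
  have h := integrableOn_rpow_mul_exp_neg_mul_sq (b := 1 / 2) (by norm_num)
    (s := ((Module.finrank ℝ (EucSpace n) - 1 + d : ℕ) : ℝ))
    (lt_of_lt_of_le (by norm_num) (Nat.cast_nonneg _))
  refine h.congr_fun (fun r _ => ?_) measurableSet_Ioi
  simp only [Real.rpow_natCast, smul_eq_mul, ← mul_assoc, ← pow_add]
  congr 2
  ring

theorem integrable_eval_mul_gaussian [NeZero n] (f : MvPolynomial (Fin n) ℝ) :
    Integrable fun x : EucSpace n => eval (fun i => x i) f * Real.exp (-‖x‖ ^ 2 / 2) := by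
  induction f using MvPolynomial.induction_on' with
  | monomial m a =>
    refine ((integrable_norm_pow_mul_gaussian n (∑ i, m i)).const_mul |a|).mono'
      ((continuous_eval_euc _).mul (by fun_prop)).aestronglyMeasurable
      (Filter.Eventually.of_forall fun x => ?_)
    rw [norm_mul, Real.norm_of_nonneg (Real.exp_pos _).le, ← mul_assoc]
    gcongr
    rw [eval_monomial, norm_mul, Real.norm_eq_abs, Finsupp.prod_fintype _ _ (by simp), norm_prod,
      ← Finset.prod_pow_eq_pow_sum]
    gcongr with i
    rw [norm_pow]
    gcongr
    exact PiLp.norm_apply_le x i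
  | add p q hp hq =>
    simp only [map_add, add_mul]
    exact hp.add hq

variable (n) in
/-- Integration of polynomials against the Gaussian weight `exp (-|x|² / 2)`. -/
def gaussianFunctional [NeZero n] : MvPolynomial (Fin n) ℝ →ₗ[ℝ] ℝ where
  toFun f := ∫ x : EucSpace n, eval (fun i => x i) f * Real.exp (-‖x‖ ^ 2 / 2)
  map_add' f g := by
    simp only [map_add, add_mul]
    exact integral_add (integrable_eval_mul_gaussian f) (integrable_eval_mul_gaussian g)
  map_smul' c f := by
    simp only [smul_eval, mul_assoc, RingHom.id_apply, smul_eq_mul]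
    exact integral_const_mul _ _

theorem gaussianFunctional_apply [NeZero n] (f : MvPolynomial (Fin n) ℝ) :
    gaussianFunctional n f =
      ∫ x : EucSpace n, eval (fun i => x i) f * Real.exp (-‖x‖ ^ 2 / 2) := rfl

/-- Integration by parts, the i-th derivative of the weight being -xᵢ times the weight. -/
theorem gaussianFunctional_X_mul [NeZero n] (i : Fin n) (f : MvPolynomial (Fin n) ℝ) :
    gaussianFunctional n (X i * f) = gaussianFunctional n (pderiv i f) := by
  have h1 : ∀ x : EucSpace n, eval (fun i => x i) f * (-(x i) * Real.exp (-‖x‖ ^ 2 / 2)) =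
      -(eval (fun i => x i) (X i * f) * Real.exp (-‖x‖ ^ 2 / 2)) := fun x => by
    simp; ring
  have h := integral_bilinear_hasLineDerivAt_right_eq_neg_left_of_integrable
    (μ := (volume : Measure (EucSpace n))) (B := ContinuousLinearMap.mul ℝ ℝ)
    (f := fun x : EucSpace n => eval (fun i => x i) f)
    (f' := fun x : EucSpace n => eval (fun i => x i) (pderiv i f))
    (g := fun x : EucSpace n => Real.exp (-‖x‖ ^ 2 / 2))
    (g' := fun x : EucSpace n => -(x i) * Real.exp (-‖x‖ ^ 2 / 2))
    (v := EuclideanSpace.single i 1)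
    (by simpa using integrable_eval_mul_gaussian (pderiv i f))
    (by
      simp only [ContinuousLinearMap.mul_apply', h1]
      exact (integrable_eval_mul_gaussian (X i * f)).neg)
    (by simpa using integrable_eval_mul_gaussian f)
    (fun x _ => hasLineDerivAt_eval f i x) (fun x _ => hasLineDerivAt_gaussian i x)
  simp only [ContinuousLinearMap.mul_apply', h1, integral_neg] at h
  rw [gaussianFunctional_apply, gaussianFunctional_apply]
  linarith

theorem gaussianFunctional_one_pos [NeZero n] : 0 < gaussianFunctional n 1 := by
  have h := integrable_eval_mul_gaussian (1 : MvPolynomial (Fin n) ℝ)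
  rw [gaussianFunctional_apply]
  simp only [map_one, one_mul] at h ⊢
  exact integral_exp_pos h

/-- Integration in polar coordinates of a product of an angular and a radial function. -/
theorem integral_eq_toSphere_mul [NeZero n] {F : EucSpace n → ℝ} {G : UnitSphere n → ℝ}
    {H : ℝ → ℝ} (hF : ∀ (θ : UnitSphere n) (r : ℝ), 0 < r → F (r • (θ : EucSpace n)) = G θ * H r) :
    ∫ x, F x = (∫ θ, G θ ∂((volume : Measure (EucSpace n)).toSphere)) *
      ∫ r : Ioi (0 : ℝ), H r ∂(Measure.volumeIoiPow (Module.finrank ℝ (EucSpace n) - 1)) := by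
  have : Nontrivial (EucSpace n) :=
    Module.nontrivial_of_finrank_pos (R := ℝ) (by simp [Nat.pos_of_ne_zero (NeZero.ne n)])
  have h := (volume : Measure (EucSpace n)).measurePreserving_homeomorphUnitSphereProd.integral_comp
    (Homeomorph.measurableEmbedding _) (fun z => G z.1 * H z.2)
  rw [integral_prod_mul (fun θ => G θ) (fun r : Ioi (0 : ℝ) => H r)] at h
  rw [← h]
  calc ∫ x, F x = ∫ x : ({0}ᶜ : Set (EucSpace n)), F x ∂(volume.comap Subtype.val) := by
        rw [integral_subtype_comap (measurableSet_singleton _).compl F,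
          restrict_compl_singleton]
    _ = _ := by
      refine integral_congr_ae (Filter.Eventually.of_forall fun x => ?_)
      have hx : 0 < ‖(x : EucSpace n)‖ := norm_pos_iff.2 x.2
      have h2 := hF ((homeomorphUnitSphereProd (EucSpace n)) x).1
        ((homeomorphUnitSphereProd (EucSpace n)) x).2
        ((homeomorphUnitSphereProd (EucSpace n)) x).2.2
      refine Eq.trans ?_ h2
      simp [smul_smul, hx.ne']

theorem eval_smul_of_isHomogeneous {f : MvPolynomial (Fin n) ℝ} {d : ℕ} (hf : f.IsHomogeneous d)
    (r : ℝ) (x : EucSpace n) :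
    eval (fun i => (r • x) i) f = r ^ d * eval (fun i => x i) f := by
  rw [eval_eq', eval_eq', Finset.mul_sum]
  refine Finset.sum_congr rfl fun m hm => ?_
  have h : ∑ i, m i = d := by
    have := hf (mem_support_iff.1 hm)
    simpa [Finsupp.weight_apply, Finsupp.sum_fintype] using this
  simp only [PiLp.smul_apply, smul_eq_mul, mul_pow, Finset.prod_mul_distrib,
    Finset.prod_pow_eq_pow_sum, h]
  ring

/-- Both Zₖp and |x|²ᵏ are homogeneous of degree 2k, so their Gaussian integrals share the radial
factor `I`. Their quotient is the average over the sphere, and `radialMoment` cancels. -/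
theorem average_zonalHarmonic_mul [NeZero n] {y : EucSpace n} (hy : ‖y‖ = 1) {k : ℕ}
    (p : harmonicSpace n k) :
    (⨍ θ : UnitSphere n, harmonicEval (zonalHarmonic hy k) θ * harmonicEval p θ
      ∂((volume : Measure (EucSpace n)).toSphere)) = harmonicEval p y := by
  set I := ∫ r : Ioi (0 : ℝ), (r : ℝ) ^ (2 * k) * Real.exp (-(r : ℝ) ^ 2 / 2)
    ∂(Measure.volumeIoiPow (Module.finrank ℝ (EucSpace n) - 1)) with hI
  have key : ∀ f : MvPolynomial (Fin n) ℝ, f.IsHomogeneous (2 * k) → gaussianFunctional n f =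
      (∫ θ : UnitSphere n, eval (fun i => (θ : EucSpace n) i) f
        ∂((volume : Measure (EucSpace n)).toSphere)) * I := fun f hf => by
    rw [gaussianFunctional_apply]
    refine integral_eq_toSphere_mul (n := n)
      (H := fun r => r ^ (2 * k) * Real.exp (-r ^ 2 / 2)) fun θ r hr => ?_
    rw [eval_smul_of_isHomogeneous hf, norm_smul, norm_eq_of_mem_sphere, Real.norm_of_nonneg hr.le]
    ring_nf
  have h1 := key (normSqPoly n ^ k) (isHomogeneous_normSqPoly.pow k)
  have h2 := key ((zonalHarmonic hy k : MvPolynomial (Fin n) ℝ) * p) (by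
    have := (isHomogeneous_zonalSeq (ν := n / 2) (isHomogeneous_linearFormPoly y)
      isHomogeneous_normSqPoly k).mul (show (p : MvPolynomial (Fin n) ℝ).IsHomogeneous k from p.2.1)
    rwa [← two_mul] at this)
  rw [functional_normSqPoly_pow (E := gaussianFunctional n)
    gaussianFunctional_X_mul] at h1
  rw [functional_zonalHarmonic_mul (E := gaussianFunctional n)
    gaussianFunctional_X_mul] at h2
  have hm : 0 < radialMoment n k := Finset.prod_pos fun j _ => by
    have : (0 : ℝ) < n := by exact_mod_cast Nat.pos_of_ne_zero (NeZero.ne n)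
    positivity
  have hpos : 0 < radialMoment n k * gaussianFunctional n 1 :=
    mul_pos hm gaussianFunctional_one_pos
  simp only [map_pow, eval_normSqPoly, norm_eq_of_mem_sphere, one_pow, integral_const,
    smul_eq_mul, mul_one] at h1
  have hSI := hpos
  rw [h1] at hSI
  have hS := left_ne_zero_of_mul hSI.ne'
  have hI0 := right_ne_zero_of_mul hSI.ne'
  rw [average_eq, smul_eq_mul]
  have h3 : (∫ θ : UnitSphere n, harmonicEval (zonalHarmonic hy k) θ * harmonicEval p θ
      ∂((volume : Measure (EucSpace n)).toSphere)) * I =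
      harmonicEval p y * ((volume : Measure (EucSpace n)).toSphere.real univ * I) := by
    rw [← h1]
    simp only [map_mul] at h2
    unfold harmonicEval at h2 ⊢
    rw [← h2]; ring
  field_simp
  refine mul_right_cancel₀ hI0 ?_
  rw [h3]; ring

end Gaussian

/-! ### The addition theorem for spherical harmonics -/

section Addition

open MvPolynomial

variable {n k : ℕ}

theorem harmonicEval_sum_smul {ι : Type*} (s : Finset ι) (c : ι → ℝ) (p : ι → harmonicSpace n k)
    (x : EucSpace n) :
    harmonicEval (∑ i ∈ s, c i • p i) x = ∑ i ∈ s, c i * harmonicEval (p i) x := by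
  simp [harmonicEval, smul_eval]

theorem harmonicEval_smul_vec (p : harmonicSpace n k) (r : ℝ) (x : EucSpace n) :
    harmonicEval p (r • x) = r ^ k * harmonicEval p x :=
  eval_smul_of_isHomogeneous p.2.1 r x

theorem integrable_toSphere_of_continuous [NeZero n] {f : UnitSphere n → ℝ} (hf : Continuous f) :
    Integrable f (volume : Measure (EucSpace n)).toSphere :=
  hf.integrable_of_hasCompactSupport (HasCompactSupport.of_compactSpace _)

theorem continuous_harmonicEval_mul (p q : harmonicSpace n k) :
    Continuous fun θ : UnitSphere n => harmonicEval p θ * harmonicEval q θ :=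
  ((continuous_harmonicEval p).comp continuous_subtype_val).mul
    ((continuous_harmonicEval q).comp continuous_subtype_val)

variable {Y : ∀ k : ℕ, Module.Basis (Fin (harmonicDim n k)) ℝ (harmonicSpace n k)}

theorem IsOrthonormalHarmonicBasis.average_mul_eq_repr [NeZero n]
    (hY : IsOrthonormalHarmonicBasis n Y) (p : harmonicSpace n k) (m : Fin (harmonicDim n k)) :
    (⨍ θ : UnitSphere n, harmonicEval p θ * harmonicEval (Y k m) θ
      ∂((volume : Measure (EucSpace n)).toSphere)) = (Y k).repr p m := by
  have h1 : ∀ x, harmonicEval p x = ∑ l, (Y k).repr p l * harmonicEval (Y k l) x := fun x => by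
    rw [← harmonicEval_sum_smul, (Y k).sum_repr]
  have h2 : ∀ l, (⨍ θ : UnitSphere n, harmonicEval (Y k l) θ * harmonicEval (Y k m) θ
      ∂((volume : Measure (EucSpace n)).toSphere)) = if l = m then 1 else 0 := fun l => hY k l m
  simp only [average_eq, smul_eq_mul] at h2 ⊢
  simp only [h1, Finset.sum_mul, mul_assoc]
  rw [integral_finsetSum _ fun l _ =>
    (integrable_toSphere_of_continuous (continuous_harmonicEval_mul _ _)).const_mul _]
  simp only [integral_const_mul, Finset.mul_sum, mul_left_comm _ ((Y k).repr p _), h2]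
  simp

/-- The addition theorem, for a pole on the unit sphere. -/
theorem IsOrthonormalHarmonicBasis.sum_mul_eq_zonalHarmonic [NeZero n]
    (hY : IsOrthonormalHarmonicBasis n Y) {y : EucSpace n} (hy : ‖y‖ = 1) (k : ℕ)
    (x : EucSpace n) :
    ∑ l, harmonicEval (Y k l) x * harmonicEval (Y k l) y = harmonicEval (zonalHarmonic hy k) x := by
  rw [← (Y k).sum_repr (zonalHarmonic hy k), harmonicEval_sum_smul]
  refine Finset.sum_congr rfl fun l _ => ?_
  -- The coefficient of the zonal harmonic on the l-th basis vector is its average against that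
  -- vector, hence the value at y.
  rw [← hY.average_mul_eq_repr, average_zonalHarmonic_mul, mul_comm]

theorem IsOrthonormalHarmonicBasis.sum_mul_eq_zonalSeq [NeZero n]
    (hY : IsOrthonormalHarmonicBasis n Y) {x y : EucSpace n} (hx : ‖x‖ = 1) (hy : ‖y‖ = 1)
    (k : ℕ) :
    ∑ l, harmonicEval (Y k l) x * harmonicEval (Y k l) y =
      zonalSeq (n / 2) ⟪x, y⟫_ℝ 1 k := by
  rw [hY.sum_mul_eq_zonalHarmonic hy, harmonicEval_zonalHarmonic, hx, one_pow, real_inner_comm]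

theorem IsOrthonormalHarmonicBasis.sum_sq_eq_zonalSeq [NeZero n]
    (hY : IsOrthonormalHarmonicBasis n Y) {x : EucSpace n} (hx : ‖x‖ = 1) (k : ℕ) :
    ∑ l, harmonicEval (Y k l) x ^ 2 = zonalSeq (n / 2) 1 1 k := by
  have := hY.sum_mul_eq_zonalSeq hx hx k
  rw [real_inner_self_eq_norm_sq, hx, one_pow] at this
  simpa only [pow_two] using this

theorem IsOrthonormalHarmonicBasis.sq_le_zonalSeq [NeZero n]
    (hY : IsOrthonormalHarmonicBasis n Y) {x : EucSpace n} (hx : ‖x‖ = 1) (k : ℕ)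
    (l : Fin (harmonicDim n k)) : harmonicEval (Y k l) x ^ 2 ≤ zonalSeq (n / 2) 1 1 k := by
  rw [← hY.sum_sq_eq_zonalSeq hx]
  exact Finset.single_le_sum (f := fun l => harmonicEval (Y k l) x ^ 2)
    (fun _ _ => sq_nonneg _) (Finset.mem_univ l)

theorem IsOrthonormalHarmonicBasis.abs_mul_abs_le_zonalSeq [NeZero n]
    (hY : IsOrthonormalHarmonicBasis n Y) {x y : EucSpace n} (hx : ‖x‖ = 1) (hy : ‖y‖ = 1) (k : ℕ)
    (l : Fin (harmonicDim n k)) :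
    |harmonicEval (Y k l) x| * |harmonicEval (Y k l) y| ≤ zonalSeq (n / 2) 1 1 k := by
  have h1 := hY.sq_le_zonalSeq hx k l
  have h2 := hY.sq_le_zonalSeq hy k l
  rw [← sq_abs] at h1 h2
  linarith [two_mul_le_add_sq |harmonicEval (Y k l) x| |harmonicEval (Y k l) y|]

theorem exists_norm_eq_one_smul_eq [NeZero n] (x : EucSpace n) :
    ∃ y : EucSpace n, ‖y‖ = 1 ∧ x = ‖x‖ • y := by
  rcases eq_or_ne x 0 with rfl | hx
  · exact ⟨EuclideanSpace.single 0 1, by simp, by simp⟩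
  · exact ⟨‖x‖⁻¹ • x, by simp [norm_smul, hx], by simp [smul_smul, hx]⟩

/-- Reconciles the convention x/|x| = 0 at the origin with an arbitrary unit direction y: there |x|ᵏ
kills both sides when k ≥ 1, and p is constant when k = 0. -/
theorem norm_pow_mul_harmonicEval_normalize (p : harmonicSpace n k) {x y : EucSpace n}
    (hxy : x = ‖x‖ • y) : ‖x‖ ^ k * harmonicEval p (‖x‖⁻¹ • x) = ‖x‖ ^ k * harmonicEval p y := by
  rcases eq_or_ne x 0 with rfl | hx
  · have : harmonicEval p (0 : EucSpace n) = 0 ^ k * harmonicEval p y := by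
      simpa using harmonicEval_smul_vec p 0 y
    simp only [norm_zero, smul_zero, this]
    rcases k with _ | k <;> simp
  · have : ‖x‖⁻¹ • x = y := by
      nth_rewrite 2 [hxy]
      simp [smul_smul, hx]
    rw [this]

theorem IsOrthonormalHarmonicBasis.zonalSeq_one_nonneg [NeZero n]
    (hY : IsOrthonormalHarmonicBasis n Y) (k : ℕ) : 0 ≤ zonalSeq ((n : ℝ) / 2) (1 : ℝ) 1 k := by
  rw [← hY.sum_sq_eq_zonalSeq (x := EuclideanSpace.single 0 1) (by simp)]
  positivity

/-- Average ∑ₗ Yₖₗ² over the sphere: each summand averages to 1, while the sum is the constant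
Zₖ(1). -/
theorem IsOrthonormalHarmonicBasis.harmonicDim_eq_zonalSeq [NeZero n]
    (hY : IsOrthonormalHarmonicBasis n Y) (k : ℕ) :
    (harmonicDim n k : ℝ) = zonalSeq ((n : ℝ) / 2) (1 : ℝ) 1 k := by
  set σ := (volume : Measure (EucSpace n)).toSphere with hσ
  -- If the surface measure vanished, so would every average, but the reproducing property in degree
  -- 0 gives an average equal to 1.
  have h0 : NeZero σ := ⟨fun h => by
    have : (⨍ θ : UnitSphere n, harmonicEval (zonalHarmonic
      (y := EuclideanSpace.single (0 : Fin n) (1 : ℝ)) (by simp) 0) θ * harmonicEval (zonalHarmonic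
      (y := EuclideanSpace.single (0 : Fin n) (1 : ℝ)) (by simp) 0) θ ∂σ) = 1 := by
      rw [hσ, average_zonalHarmonic_mul, harmonicEval_zonalHarmonic]; rfl
    rw [h] at this
    simp at this⟩
  have h1 : ∀ l : Fin (harmonicDim n k), (⨍ θ : UnitSphere n, harmonicEval (Y k l) θ ^ 2 ∂σ) = 1 :=
    fun l => by simpa [pow_two] using hY k l l
  have h2 : (⨍ θ : UnitSphere n, ∑ l, harmonicEval (Y k l) θ ^ 2 ∂σ) =
      zonalSeq ((n : ℝ) / 2) (1 : ℝ) 1 k := by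
    simp only [hY.sum_sq_eq_zonalSeq (norm_eq_of_mem_sphere _)]
    exact average_const _ _
  rw [← h2, average_eq, integral_finsetSum _ fun l _ => by
    simpa only [pow_two] using integrable_toSphere_of_continuous (continuous_harmonicEval_mul _ _),
    Finset.smul_sum]
  simp only [← average_eq, h1]
  simp

end Addition

/-! ### The generating function -/

section GeneratingFunction

/-- Shifting a sequence to the right by one place. -/
def shiftSeq (a : ℕ → ℂ) : ℕ → ℂ
  | 0 => 0
  | k + 1 => a k

theorem HasSum.shiftSeq_mul_pow {a : ℕ → ℂ} {w S : ℂ} (h : HasSum (fun k => a k * w ^ k) S) :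
    HasSum (fun k => shiftSeq a k * w ^ k) (w * S) := by
  rw [← hasSum_nat_add_iff' 1]
  simp only [shiftSeq, Finset.sum_range_one, zero_mul, sub_zero]
  refine (h.mul_left w).congr_fun fun k => ?_
  ring

theorem eq_zero_of_hasSum_mul_pow_zero {e : ℕ → ℂ}
    (h : ∀ w : ℂ, ‖w‖ < 1 → HasSum (fun k => e k * w ^ k) 0) (k : ℕ) : e k = 0 := by
  have h1 : HasFPowerSeriesAt (0 : ℂ → ℂ) (FormalMultilinearSeries.ofScalars ℂ e) 0 := by
    rw [hasFPowerSeriesAt_iff]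
    filter_upwards [Metric.ball_mem_nhds (0 : ℂ) one_pos] with w hw
    have := h w (by simpa using hw)
    simpa [FormalMultilinearSeries.coeff_ofScalars, mul_comm] using this
  rw [← FormalMultilinearSeries.coeff_ofScalars (p := e) (𝕜 := ℂ), h1.eq_zero]
  simp [FormalMultilinearSeries.coeff]

/-- The function is holomorphic on the unit disc, so its Taylor series converges there; the equation
(1 - 2tw + w²)f' = 2ν(t - w)f forces its coefficients to satisfy the Gegenbauer recurrence. -/
theorem hasSum_gegenbauer_mul_pow (ν : ℝ) {t : ℂ}
    (ht : ∀ w : ℂ, ‖w‖ < 1 → 1 - 2 * t * w + w ^ 2 ∈ Complex.slitPlane) {w : ℂ} (hw : ‖w‖ < 1) :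
    HasSum (fun k => gegenbauer ν t 1 k * w ^ k) ((1 - 2 * t * w + w ^ 2) ^ (-ν : ℂ)) := by
  set f : ℂ → ℂ := fun w => (1 - 2 * t * w + w ^ 2) ^ (-ν : ℂ) with hf
  have hderiv : ∀ w : ℂ, ‖w‖ < 1 → HasDerivAt f
      ((-ν : ℂ) * (1 - 2 * t * w + w ^ 2) ^ ((-ν : ℂ) - 1) * (-2 * t + 2 * w)) w := by
    intro w hw
    refine HasDerivAt.cpow_const ?_ (ht w hw)
    have h1 := (((hasDerivAt_id w).const_mul (2 * t)).const_sub 1).add ((hasDerivAt_id w).pow 2)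
    exact h1.congr_deriv (by simp)
  have hd : DifferentiableOn ℂ f (ball 0 1) := fun w hw =>
    (hderiv w (by simpa using hw)).differentiableAt.differentiableWithinAt
  have hd' : DifferentiableOn ℂ (deriv f) (ball 0 1) := hd.deriv isOpen_ball
  set c : ℕ → ℂ := fun k => (k.factorial : ℂ)⁻¹ * iteratedDeriv k f 0 with hc
  have hsum : ∀ w : ℂ, ‖w‖ < 1 → HasSum (fun k => c k * w ^ k) (f w) := fun w hw => by
    have := Complex.hasSum_taylorSeries_on_ball hd (z := w) (by simpa using hw)
    refine this.congr_fun fun k => ?_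
    simp [hc]; ring
  have hsum' : ∀ w : ℂ, ‖w‖ < 1 → HasSum (fun k => ((k + 1) * c (k + 1)) * w ^ k) (deriv f w) :=
      fun w hw => by
    have := Complex.hasSum_taylorSeries_on_ball hd' (z := w) (by simpa using hw)
    refine this.congr_fun fun k => ?_
    have hk : (k : ℂ) + 1 ≠ 0 := by exact_mod_cast k.succ_ne_zero
    simp only [hc, ← iteratedDeriv_succ', Nat.factorial_succ, smul_eq_mul, sub_zero]
    push_cast
    field_simp
  have hode : ∀ w : ℂ, ‖w‖ < 1 →
      (1 - 2 * t * w + w ^ 2) * deriv f w = 2 * ν * (t - w) * f w := fun w hw => by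
    have h0 := Complex.slitPlane_ne_zero (ht w hw)
    rw [(hderiv w hw).deriv, Complex.cpow_sub _ _ h0, Complex.cpow_one]
    simp only [hf]
    field_simp
    ring
  set a : ℕ → ℂ := fun k => (k + 1) * c (k + 1) with ha
  -- The k-th Taylor coefficient of the difference of the two sides of the differential equation.
  set e : ℕ → ℂ := fun k => a k - 2 * t * shiftSeq a k + shiftSeq (shiftSeq a) k -
    2 * ν * t * c k + 2 * ν * shiftSeq c k with he
  have he0 : ∀ k, e k = 0 := eq_zero_of_hasSum_mul_pow_zero fun w hw => by
    have h1 := hsum' w hw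
    have h2 := hsum w hw
    have h3 := ((((h1.sub (h1.shiftSeq_mul_pow.mul_left (2 * t))).add
      h1.shiftSeq_mul_pow.shiftSeq_mul_pow).sub (h2.mul_left (2 * (ν : ℂ) * t))).add
      (h2.shiftSeq_mul_pow.mul_left (2 * (ν : ℂ))))
    have h4 : deriv f w - 2 * t * (w * deriv f w) + w * (w * deriv f w) - 2 * ν * t * f w +
        2 * ν * (w * f w) = 0 := by linear_combination hode w hw
    rw [h4] at h3
    refine h3.congr_fun fun k => ?_
    simp only [he]
    ring
  have hcg : ∀ k, c k = gegenbauer ν t 1 k := by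
    have hc0 : c 0 = 1 := by simp [hc, hf]
    refine eq_gegenbauer_of_recurrence hc0 ?_ fun k => ?_
    · have := he0 0
      simp only [he, ha, shiftSeq, hc0] at this
      push_cast at this
      simp only [Complex.coe_algebraMap]
      linear_combination this
    · have := he0 (k + 1)
      rcases k with _ | k
      · simp only [he, ha, shiftSeq] at this
        push_cast at this ⊢
        simp only [Complex.coe_algebraMap]
        ring_nf at this ⊢
        linear_combination this
      · simp only [he, ha, shiftSeq] at this
        push_cast at this ⊢
        simp only [Complex.coe_algebraMap]
        ring_nf at this ⊢
        linear_combination this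
  simpa only [hcg] using hsum w hw

theorem hasSum_zonalSeq_mul_pow (ν : ℝ) {t : ℂ}
    (ht : ∀ w : ℂ, ‖w‖ < 1 → 1 - 2 * t * w + w ^ 2 ∈ Complex.slitPlane) {w : ℂ} (hw : ‖w‖ < 1) :
    HasSum (fun k => zonalSeq ν t 1 k * w ^ k)
      ((1 - w ^ 2) * (1 - 2 * t * w + w ^ 2) ^ (-ν : ℂ)) := by
  have h := hasSum_gegenbauer_mul_pow ν ht hw
  have h1 := h.sub h.shiftSeq_mul_pow.shiftSeq_mul_pow
  rw [show (1 - w ^ 2) * (1 - 2 * t * w + w ^ 2) ^ (-ν : ℂ) =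
    (1 - 2 * t * w + w ^ 2) ^ (-ν : ℂ) - w * (w * (1 - 2 * t * w + w ^ 2) ^ (-ν : ℂ)) by ring]
  refine h1.congr_fun fun k => ?_
  rcases k with _ | _ | k <;> simp [zonalSeq, shiftSeq, gegenbauer_zero] <;> ring

variable {n : ℕ}

/-- This is `aronszajnRoot_slitPlane` at ζ = 1/w. -/
theorem one_sub_inner_mem_slitPlane {x y : EucSpace n} (hx : ‖x‖ = 1) (hy : ‖y‖ = 1) {w : ℂ}
    (hw : ‖w‖ < 1) : 1 - 2 * (⟪x, y⟫_ℝ : ℂ) * w + w ^ 2 ∈ Complex.slitPlane := by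
  rcases eq_or_ne w 0 with rfl | h0
  · simp
  · have := aronszajnRoot_slitPlane (ζ := w⁻¹) (θ := x) (x := y) hx (by
      rw [hy, norm_inv]
      exact (one_lt_inv₀ (norm_pos_iff.2 h0)).2 hw)
    simpa [hy] using this

/-- The Poisson kernel expansion, with a complex parameter. -/
theorem hasSum_zonalSeq_inner {x y : EucSpace n} (hx : ‖x‖ = 1) (hy : ‖y‖ = 1) {w : ℂ}
    (hw : ‖w‖ < 1) :
    HasSum (fun k => ((zonalSeq ((n : ℝ) / 2) ⟪x, y⟫_ℝ 1 k : ℝ) : ℂ) * w ^ k)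
      ((1 - w ^ 2) * (1 - 2 * (⟪x, y⟫_ℝ : ℂ) * w + w ^ 2) ^ (-((n : ℂ) / 2))) := by
  have h := hasSum_zonalSeq_mul_pow ((n : ℝ) / 2) (t := (⟪x, y⟫_ℝ : ℂ))
    (fun w hw => one_sub_inner_mem_slitPlane hx hy hw) hw
  push_cast at h
  refine h.congr_fun fun k => ?_
  have := map_zonalSeq Complex.ofRealAm ((n : ℝ) / 2) ⟪x, y⟫_ℝ 1 k
  simp only [Complex.ofRealAm_coe, Complex.ofReal_one] at this
  rw [this]

theorem summable_zonalSeq_one [NeZero n] {r : ℝ} (h0 : 0 ≤ r) (h1 : r < 1) :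
    Summable fun k => zonalSeq ((n : ℝ) / 2) (1 : ℝ) 1 k * r ^ k := by
  have h := (hasSum_zonalSeq_inner (x := EuclideanSpace.single (0 : Fin n) (1 : ℝ))
    (y := EuclideanSpace.single (0 : Fin n) (1 : ℝ)) (by simp) (by simp) (w := (r : ℂ))
    (by rwa [Complex.norm_real, Real.norm_of_nonneg h0])).summable
  rw [real_inner_self_eq_norm_sq] at h
  simp only [PiLp.norm_single, norm_one, one_pow] at h
  exact_mod_cast h

/-- The terms are squares of those of the convergent series at √q. The square is needed because
degree k contributes dₖ = Zₖ(1) terms, each bounded by Zₖ(1)qᵏ. -/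
theorem summable_zonalSeq_one_sq [NeZero n] {q : ℝ} (h0 : 0 ≤ q) (h1 : q < 1) :
    Summable fun k => zonalSeq ((n : ℝ) / 2) (1 : ℝ) 1 k ^ 2 * q ^ k := by
  have hs := (summable_zonalSeq_one (n := n) (Real.sqrt_nonneg q)
    ((Real.sqrt_lt_sqrt h0 h1).trans_eq Real.sqrt_one)).norm
  refine Summable.of_nonneg_of_le (fun k => by positivity) (fun k => ?_) (hs.mul_left
    (∑' k, ‖zonalSeq ((n : ℝ) / 2) (1 : ℝ) 1 k * √q ^ k‖))
  have h2 : zonalSeq ((n : ℝ) / 2) (1 : ℝ) 1 k ^ 2 * q ^ k =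
      ‖zonalSeq ((n : ℝ) / 2) (1 : ℝ) 1 k * √q ^ k‖ *
        ‖zonalSeq ((n : ℝ) / 2) (1 : ℝ) 1 k * √q ^ k‖ := by
    rw [← pow_two, Real.norm_eq_abs, sq_abs, mul_pow, ← pow_mul, mul_comm k 2, pow_mul,
      Real.sq_sqrt h0]
  rw [h2]
  exact mul_le_mul_of_nonneg_right (hs.le_tsum k fun _ _ => norm_nonneg _) (norm_nonneg _)

end GeneratingFunction

/-! ### Integrals against signed measures -/

section SignedMeasureIntegral

variable {X : Type*} [MeasurableSpace X]

theorem isFiniteMeasure_variation (μ : SignedMeasure X) : IsFiniteMeasure μ.variation := by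
  rw [← SignedMeasure.totalVariation_eq_variation]; infer_instance

theorem signedMeasure_integrable_of_bound {E : Type*} [NormedAddCommGroup E]
    (μ : SignedMeasure X) {f : X → E} (hf : AEStronglyMeasurable f μ.variation) {C : ℝ}
    (hC : ∀ᵐ x ∂μ.variation, ‖f x‖ ≤ C) : VectorMeasure.Integrable μ f := by
  have := isFiniteMeasure_variation μ
  exact Integrable.of_bound hf C hC

/-- The integral against a signed measure, through its Jordan decomposition. -/
theorem signedMeasure_integral_eq_sub {E : Type*} [NormedAddCommGroup E] [NormedSpace ℝ E]
    (μ : SignedMeasure X) {f : X → E} (hf : VectorMeasure.Integrable μ f) :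
    ∫ᵛ x, f x ∂<•μ = ∫ x, f x ∂μ.toJordanDecomposition.posPart -
      ∫ x, f x ∂μ.toJordanDecomposition.negPart := by
  have hf' : Integrable f (μ.toJordanDecomposition.posPart + μ.toJordanDecomposition.negPart) := by
    rw [VectorMeasure.Integrable, ← SignedMeasure.totalVariation_eq_variation] at hf
    exact hf
  rw [integrable_add_measure] at hf'
  conv_lhs => rw [← SignedMeasure.toSignedMeasure_toJordanDecomposition μ]
  rw [JordanDecomposition.toSignedMeasure, VectorMeasure.integral_sub_vectorMeasure
    (by simpa [VectorMeasure.Integrable] using hf'.1)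
    (by simpa [VectorMeasure.Integrable] using hf'.2),
    VectorMeasure.integral_toSignedMeasure, VectorMeasure.integral_toSignedMeasure]

theorem signedMeasure_integral_const_mul (μ : SignedMeasure X) (c : ℂ) {f : X → ℂ}
    (hf : VectorMeasure.Integrable μ f) : ∫ᵛ x, c * f x ∂<•μ = c * ∫ᵛ x, f x ∂<•μ := by
  rw [signedMeasure_integral_eq_sub μ hf,
    signedMeasure_integral_eq_sub μ (Integrable.const_mul hf c), integral_const_mul,
    integral_const_mul, mul_sub]

theorem signedMeasure_integral_re_add_im (μ : SignedMeasure X) {f : X → ℂ}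
    (hf : VectorMeasure.Integrable μ f) :
    ∫ᵛ x, f x ∂<•μ = (∫ᵛ x, (f x).re ∂<•μ : ℝ) + (∫ᵛ x, (f x).im ∂<•μ : ℝ) * Complex.I := by
  have hf' : Integrable f (μ.toJordanDecomposition.posPart + μ.toJordanDecomposition.negPart) := by
    rw [VectorMeasure.Integrable, ← SignedMeasure.totalVariation_eq_variation] at hf
    exact hf
  rw [integrable_add_measure] at hf'
  have h1 := integral_re_add_im hf'.1
  have h2 := integral_re_add_im hf'.2
  have h3 : VectorMeasure.Integrable μ (fun x => (f x).re) := Integrable.re hf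
  have h4 : VectorMeasure.Integrable μ (fun x => (f x).im) := Integrable.im hf
  rw [signedMeasure_integral_eq_sub μ hf, signedMeasure_integral_eq_sub μ h3,
    signedMeasure_integral_eq_sub μ h4, ← h1, ← h2]
  simp
  ring

/-- Integration of a bounded complex function against a signed measure with bounded density. -/
theorem complex_integral_withDensity_bounded (μ : SignedMeasure X)
    {g : X → ℝ} {f : X → ℂ} (hg : Measurable g) {C : ℝ} (hC : ∀ x, ‖g x‖ ≤ C)
    (hf : Measurable f) {D : ℝ} (hD : ∀ x, ‖f x‖ ≤ D) :
    ∫ᵛ x, f x ∂<•(VectorMeasure.withDensity μ g (ContinuousLinearMap.lsmul ℝ ℝ)) =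
      ∫ᵛ x, f x * g x ∂<•μ := by
  have h1 := signedMeasure_integrable_of_bound (VectorMeasure.withDensity μ g
    (ContinuousLinearMap.lsmul ℝ ℝ)) hf.aestronglyMeasurable (Filter.Eventually.of_forall hD)
  have h2 : VectorMeasure.Integrable μ (fun x => f x * g x) :=
    signedMeasure_integrable_of_bound μ (C := D * C)
      (hf.mul (Complex.measurable_ofReal.comp hg)).aestronglyMeasurable
      (Filter.Eventually.of_forall fun x => by
        rw [norm_mul, Complex.norm_real]
        exact mul_le_mul (hD x) (hC x) (norm_nonneg _) ((norm_nonneg _).trans (hD x)))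
  rw [signedMeasure_integral_re_add_im _ h1, signedMeasure_integral_re_add_im _ h2,
    integral_withDensity_bounded (f := fun x => (f x).re) μ hg hC
      (Complex.measurable_re.comp hf).stronglyMeasurable
      (fun x => (Complex.abs_re_le_norm _).trans (hD x)),
    integral_withDensity_bounded (f := fun x => (f x).im) μ hg hC
      (Complex.measurable_im.comp hf).stronglyMeasurable
      (fun x => (Complex.abs_im_le_norm _).trans (hD x))]
  simp

variable {n k : ℕ}

/-- Extends the defining identity from continuous compactly supported real F to complex measurable
integrands bounded on s, as required for rᵏ/(ζ² - r²) cut off to [0, R]. -/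
theorem componentMeasure_setIntegral_eq (μ : SignedMeasure (EucSpace n)) (p : harmonicSpace n k)
    {s : Set ℝ} (hs : MeasurableSet s) {f : ℝ → ℂ} (hf : Measurable f) {D : ℝ}
    (hD : ∀ r ∈ s, ‖f r‖ ≤ D) (hD0 : 0 ≤ D) :
    VectorMeasure.IntegrableOn (componentMeasure μ p) f s ∧
    ∫ᵛ r in s, f r ∂<•(componentMeasure μ p) =
      ∫ᵛ x, s.indicator f ‖x‖ * harmonicEval p (‖x‖⁻¹ • x) ∂<•μ := by
  obtain ⟨C, hC⟩ := exists_bound_harmonicEval p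
  have hfs : Measurable (s.indicator f) := hf.indicator hs
  have hb : ∀ r, ‖s.indicator f r‖ ≤ D := fun r => by
    by_cases hr : r ∈ s
    · simpa [hr] using hD r hr
    · simpa [hr] using hD0
  refine ⟨?_, ?_⟩
  · rw [← VectorMeasure.integrable_indicator_iff hs]
    exact signedMeasure_integrable_of_bound _ hfs.aestronglyMeasurable
      (Filter.Eventually.of_forall hb)
  · rw [← VectorMeasure.integral_indicator hs, componentMeasure,
      VectorMeasure.integral_map measurable_norm hfs.aestronglyMeasurable]
    · exact complex_integral_withDensity_bounded μ (measurable_harmonicEval_normalize p) hC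
        (hfs.comp measurable_norm) (fun x => hb _)
    · exact signedMeasure_integrable_of_bound _ (hfs.comp measurable_norm).aestronglyMeasurable
        (Filter.Eventually.of_forall fun x => hb _)

theorem signedMeasure_hasSum_integral {ι : Type*} [Countable ι]
    (μ : SignedMeasure X) {F : ι → X → ℂ} {f : X → ℂ} {b : ι → ℝ}
    (hF : ∀ i, AEStronglyMeasurable (F i) μ.variation)
    (hb : ∀ i, ∀ᵐ x ∂μ.variation, ‖F i x‖ ≤ b i) (hs : Summable b)
    (hlim : ∀ᵐ x ∂μ.variation, HasSum (fun i => F i x) (f x)) :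
    HasSum (fun i => ∫ᵛ x, F i x ∂<•μ) (∫ᵛ x, f x ∂<•μ) := by
  have := isFiniteMeasure_variation μ
  exact VectorMeasure.hasSum_integral_of_dominated_convergence (fun i _ => b i) hF hb
    (Filter.Eventually.of_forall fun _ => hs) (integrable_const (∑' i, b i)) hlim

end SignedMeasureIntegral

/-! ### The Klein-Dirac quadric -/

section KleinDirac

variable {n : ℕ}

/-- The absolute value `|ζ|` of a point `ζθ` of the Klein-Dirac quadric. -/
def KDQ.norm : KDQ n → ℝ :=
  Quotient.lift (fun p : ℂ × UnitSphere n => ‖p.1‖) fun p q h => by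
    rcases h with h | h <;> simp [h]

theorem KDQ.continuous_norm : Continuous (KDQ.norm (n := n)) :=
  Continuous.quotient_lift (s := kdqSetoid n) continuous_fst.norm _

theorem KDQ.continuous_mk : Continuous fun p : ℂ × UnitSphere n => KDQ.mk p.1 p.2 :=
  continuous_quotient_mk' (s := kdqSetoid n)

theorem KDQ.mk_mem_closure_ball {R : ℝ} (hR : 0 < R) {ζ : ℂ} (hζ : ‖ζ‖ ≤ R) (θ : UnitSphere n) :
    KDQ.mk ζ θ ∈ closure (KDQ.ball n R) := by
  have h1 : Continuous fun ζ : ℂ => KDQ.mk ζ θ :=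
    KDQ.continuous_mk.comp (continuous_id.prodMk continuous_const)
  have h2 : ζ ∈ closure (Metric.ball (0 : ℂ) R) := by
    rw [closure_ball _ hR.ne']
    simpa using hζ
  exact map_mem_closure (f := fun ζ => KDQ.mk ζ θ) h1 h2 fun w hw => ⟨w, θ, by simpa using hw, rfl⟩

/-- The modulus |ζ| is well defined and continuous on the quotient, so it attains a minimum on K;
that minimum exceeds R because points with |ζ| ≤ R lie in the closure of the ball. -/
theorem KDQ.exists_lt_norm_of_isCompact {R : ℝ} (hR : 0 < R) {K : Set (KDQ n)} (hK : IsCompact K)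
    (hKR : K ⊆ (closure (KDQ.ball n R))ᶜ) :
    ∃ R' : ℝ, R < R' ∧ ∀ (ζ : ℂ) (θ : UnitSphere n), KDQ.mk ζ θ ∈ K → R' ≤ ‖ζ‖ := by
  rcases K.eq_empty_or_nonempty with rfl | hne
  · exact ⟨R + 1, by linarith, fun _ _ h => h.elim⟩
  · obtain ⟨p, hp, hmin⟩ := hK.exists_isMinOn hne KDQ.continuous_norm.continuousOn
    refine ⟨KDQ.norm p, ?_, fun ζ θ h => hmin h⟩
    obtain ⟨⟨ζ, θ⟩, rfl⟩ := Quotient.exists_rep p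
    by_contra! hcon
    exact hKR hp (KDQ.mk_mem_closure_ball hR hcon θ)

end KleinDirac

/-! ### The series expansion of the Hua-Aronszajn kernel -/

section KernelExpansion

variable {n : ℕ}

theorem norm_sub_sq_ge {ζ : ℂ} {r : ℝ} :
    ‖ζ‖ ^ 2 - r ^ 2 ≤ ‖ζ ^ 2 - (r : ℂ) ^ 2‖ := by
  have := norm_sub_norm_le (ζ ^ 2) ((r : ℂ) ^ 2)
  simpa [norm_pow, Complex.norm_real] using this

theorem sq_sub_sq_ne_zero {ζ : ℂ} {r : ℝ} (h0 : 0 ≤ r) (hr : r < ‖ζ‖) :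
    ζ ^ 2 - (r : ℂ) ^ 2 ≠ 0 := by
  have h1 : r ^ 2 < ‖ζ‖ ^ 2 := pow_lt_pow_left₀ hr h0 two_ne_zero
  exact norm_pos_iff.1 (lt_of_lt_of_le (by linarith) norm_sub_sq_ge)

theorem norm_radial_factor_le {ζ : ℂ} {r R R' : ℝ} (h0 : 0 ≤ r) (hr : r ≤ R) (hR : R < R')
    (hζ : R' ≤ ‖ζ‖) (k : ℕ) :
    ‖ζ ^ (-(k : ℤ) + 1) * ((r : ℂ) ^ k / (ζ ^ 2 - (r : ℂ) ^ 2))‖ ≤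
      (R' - R)⁻¹ * (R / R') ^ k := by
  have hz : 0 < ‖ζ‖ := by linarith
  have hz0 : ζ ≠ 0 := norm_pos_iff.1 hz
  have hd : 0 < ‖ζ‖ ^ 2 - r ^ 2 := by nlinarith
  have hd' := hd.trans_le (norm_sub_sq_ge (ζ := ζ) (r := r))
  have h1 : ‖ζ ^ (-(k : ℤ) + 1) * ((r : ℂ) ^ k / (ζ ^ 2 - (r : ℂ) ^ 2))‖ =
      ‖ζ‖ / ‖ζ ^ 2 - (r : ℂ) ^ 2‖ * (r / ‖ζ‖) ^ k := by
    rw [norm_mul, norm_div, norm_zpow, norm_pow, Complex.norm_real, Real.norm_of_nonneg h0,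
      zpow_add₀ hz.ne', zpow_neg, zpow_natCast, zpow_one, div_pow]
    field_simp
  rw [h1]
  have h2 : r / ‖ζ‖ ≤ R / R' := by
    apply div_le_div₀ (h0.trans hr) hr (by linarith) hζ
  -- Here |ζ² - r²| ≥ (|ζ| - r)(|ζ| + r) ≥ (R' - R)|ζ|.
  have h3 : ‖ζ‖ / ‖ζ ^ 2 - (r : ℂ) ^ 2‖ ≤ (R' - R)⁻¹ := by
    rw [← one_div, div_le_div_iff₀ hd' (by linarith)]
    refine le_trans ?_ ((one_mul (‖ζ‖ ^ 2 - r ^ 2)).le.trans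
      (by simpa using norm_sub_sq_ge (ζ := ζ) (r := r)))
    nlinarith
  gcongr

variable {Y : ∀ k : ℕ, Module.Basis (Fin (harmonicDim n k)) ℝ (harmonicSpace n k)}

theorem IsOrthonormalHarmonicBasis.summable_bound [NeZero n]
    (hY : IsOrthonormalHarmonicBasis n Y) (C : ℝ) {q : ℝ} (h0 : 0 ≤ q) (h1 : q < 1) :
    Summable fun a : Σ k : ℕ, Fin (harmonicDim n k) =>
      C * q ^ a.1 * zonalSeq ((n : ℝ) / 2) (1 : ℝ) 1 a.1 := by
  suffices h : Summable fun a : Σ k : ℕ, Fin (harmonicDim n k) =>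
      q ^ a.1 * zonalSeq ((n : ℝ) / 2) (1 : ℝ) 1 a.1 by
    simpa only [mul_assoc] using h.mul_left C
  rw [summable_sigma_of_nonneg fun a => mul_nonneg (pow_nonneg h0 _) (hY.zonalSeq_one_nonneg _)]
  refine ⟨fun k => Summable.of_finite, ?_⟩
  refine (summable_zonalSeq_one_sq (n := n) h0 h1).congr fun k => ?_
  simp only [tsum_fintype, Finset.sum_const, Finset.card_univ, Fintype.card_fin, nsmul_eq_mul]
  rw [hY.harmonicDim_eq_zonalSeq]
  ring

/-- An integer power of the principal root is the principal power with exponent n/2, so no branch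
question arises; ζ^(n-1)/ζⁿ leaves ζ⁻¹. -/
theorem huaAronszajnKernel_eq (hn : 1 ≤ n) {ζ : ℂ} (hζ : ζ ≠ 0) (θ x : EucSpace n) :
    huaAronszajnKernel n ζ θ x =
      ζ⁻¹ * (1 - 2 * (⟪θ, x⟫_ℝ : ℂ) / ζ + (‖x‖ : ℂ) ^ 2 / ζ ^ 2) ^ (-((n : ℂ) / 2)) := by
  obtain ⟨m, rfl⟩ : ∃ m, n = m + 1 := ⟨n - 1, by omega⟩
  rw [huaAronszajnKernel, aronszajnRoot, mul_pow, ← Complex.cpow_nat_mul, Complex.cpow_neg,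
    Nat.add_sub_cancel, pow_succ, mul_one_div]
  field_simp

/-- The terms of the series expansion of the Hua-Aronszajn kernel. -/
def kernelTerm (Y : ∀ k : ℕ, Module.Basis (Fin (harmonicDim n k)) ℝ (harmonicSpace n k))
    (ζ : ℂ) (θ x : EucSpace n) (a : Σ k : ℕ, Fin (harmonicDim n k)) : ℂ :=
  ζ ^ (-(a.1 : ℤ) + 1) * (harmonicEval (Y a.1 a.2) θ : ℂ) *
    ((‖x‖ : ℂ) ^ a.1 / (ζ ^ 2 - (‖x‖ : ℂ) ^ 2) * harmonicEval (Y a.1 a.2) (‖x‖⁻¹ • x))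

theorem kernelTerm_eq {x y : EucSpace n} (hxy : x = ‖x‖ • y) (ζ : ℂ) (θ : EucSpace n)
    (a : Σ k : ℕ, Fin (harmonicDim n k)) :
    kernelTerm Y ζ θ x a = ζ ^ (-(a.1 : ℤ) + 1) * ((‖x‖ : ℂ) ^ a.1 / (ζ ^ 2 - (‖x‖ : ℂ) ^ 2)) *
      ((harmonicEval (Y a.1 a.2) θ * harmonicEval (Y a.1 a.2) y : ℝ) : ℂ) := by
  have h : ((‖x‖ : ℂ) ^ a.1 * harmonicEval (Y a.1 a.2) (‖x‖⁻¹ • x) : ℂ) =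
      (‖x‖ : ℂ) ^ a.1 * harmonicEval (Y a.1 a.2) y := by
    exact_mod_cast norm_pow_mul_harmonicEval_normalize (Y a.1 a.2) hxy
  rw [kernelTerm, div_mul_eq_mul_div, h]
  push_cast
  ring

theorem IsOrthonormalHarmonicBasis.norm_kernelTerm_le [NeZero n]
    (hY : IsOrthonormalHarmonicBasis n Y) {ζ : ℂ} {θ x : EucSpace n} {R R' : ℝ} (hθ : ‖θ‖ = 1)
    (hx : ‖x‖ ≤ R) (hR : R < R') (hζ : R' ≤ ‖ζ‖) (a : Σ k : ℕ, Fin (harmonicDim n k)) :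
    ‖kernelTerm Y ζ θ x a‖ ≤
      (R' - R)⁻¹ * (R / R') ^ a.1 * zonalSeq ((n : ℝ) / 2) (1 : ℝ) 1 a.1 := by
  obtain ⟨y, hy, hxy⟩ := exists_norm_eq_one_smul_eq x
  rw [kernelTerm_eq hxy, norm_mul, Complex.norm_real, Real.norm_eq_abs, abs_mul]
  have h0 : 0 ≤ R := (norm_nonneg x).trans hx
  have h1 := norm_radial_factor_le (norm_nonneg x) hx hR hζ a.1
  exact mul_le_mul h1 (hY.abs_mul_abs_le_zonalSeq hθ hy _ _) (by positivity)
    ((norm_nonneg _).trans h1)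

theorem IsOrthonormalHarmonicBasis.hasSum_kernelTerm [NeZero n]
    (hY : IsOrthonormalHarmonicBasis n Y) {ζ : ℂ} {θ x : EucSpace n} (hθ : ‖θ‖ = 1)
    (hx : ‖x‖ < ‖ζ‖) : HasSum (kernelTerm Y ζ θ x) (huaAronszajnKernel n ζ θ x) := by
  obtain ⟨y, hy, hxy⟩ := exists_norm_eq_one_smul_eq x
  have hz : 0 < ‖ζ‖ := (norm_nonneg x).trans_lt hx
  have hz0 : ζ ≠ 0 := norm_pos_iff.1 hz
  have hd := sq_sub_sq_ne_zero (norm_nonneg x) hx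
  set w : ℂ := (‖x‖ : ℂ) / ζ with hw
  have hw1 : ‖w‖ < 1 := by
    rw [hw, norm_div, Complex.norm_real, norm_norm]
    exact (div_lt_one hz).2 hx
  have hinner : ⟪θ, x⟫_ℝ = ‖x‖ * ⟪θ, y⟫_ℝ := by
    conv_lhs => rw [hxy]
    rw [inner_smul_right]
  have hw2 : 1 - w ^ 2 = (ζ ^ 2 - (‖x‖ : ℂ) ^ 2) / ζ ^ 2 := by
    rw [hw]; field_simp
  have hsum : HasSum (fun k : ℕ => ∑ l, kernelTerm Y ζ θ x ⟨k, l⟩)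
      (huaAronszajnKernel n ζ θ x) := by
    have h := (hasSum_zonalSeq_inner hθ hy hw1).mul_left (ζ⁻¹ * (1 - w ^ 2)⁻¹)
    have e1 : ζ⁻¹ * (1 - w ^ 2)⁻¹ *
        ((1 - w ^ 2) * (1 - 2 * (⟪θ, y⟫_ℝ : ℂ) * w + w ^ 2) ^ (-((n : ℂ) / 2))) =
        huaAronszajnKernel n ζ θ x := by
      have h1 : 1 - w ^ 2 ≠ 0 := by
        rw [hw2]; exact div_ne_zero hd (pow_ne_zero _ hz0)
      have h2 : 1 - 2 * (⟪θ, x⟫_ℝ : ℂ) / ζ + (‖x‖ : ℂ) ^ 2 / ζ ^ 2 =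
          1 - 2 * (⟪θ, y⟫_ℝ : ℂ) * w + w ^ 2 := by
        rw [hinner, hw]
        push_cast
        ring
      rw [huaAronszajnKernel_eq (Nat.one_le_iff_ne_zero.2 (NeZero.ne n)) hz0, h2, mul_assoc,
        inv_mul_cancel_left₀ h1]
    rw [e1] at h
    refine h.congr_fun fun k => ?_
    simp only [kernelTerm_eq hxy]
    rw [← Finset.mul_sum, ← Complex.ofReal_sum, hY.sum_mul_eq_zonalSeq hθ hy, hw2, hw,
      zpow_add₀ hz0, zpow_neg, zpow_natCast, zpow_one, div_pow]
    field_simp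
  -- Summing degree by degree gives the value; summability of the full family over (k, ℓ) comes from
  -- the majorant, with |x| and |ζ| as the two radii.
  refine HasSum.sigma_of_hasSum hsum (fun k => hasSum_fintype _) ?_
  refine Summable.of_norm_bounded (hY.summable_bound (‖ζ‖ - ‖x‖)⁻¹ (by positivity)
    ((div_lt_one hz).2 hx)) fun a => hY.norm_kernelTerm_le hθ le_rfl hx le_rfl a

theorem measurable_kernelTerm (ζ : ℂ) (θ : EucSpace n) (a : Σ k : ℕ, Fin (harmonicDim n k)) :
    Measurable fun x => kernelTerm Y ζ θ x a := by
  have := Complex.measurable_ofReal.comp (measurable_harmonicEval_normalize (Y a.1 a.2))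
  unfold kernelTerm
  refine Measurable.const_mul (Measurable.mul (by fun_prop) this) _

/-- The moments of the component measures are integrals of the terms of the kernel expansion. -/
theorem integral_kernelTerm
    (Y : ∀ k : ℕ, Module.Basis (Fin (harmonicDim n k)) ℝ (harmonicSpace n k))
    {R : ℝ} {μ : SignedMeasure (EucSpace n)} (hμ : ∀ᵐ x ∂μ.variation, ‖x‖ ≤ R) (hR : 0 < R)
    {ζ : ℂ} (hζ : R < ‖ζ‖) (θ : EucSpace n) (a : Σ k : ℕ, Fin (harmonicDim n k)) :
    VectorMeasure.IntegrableOn (componentMeasure μ (Y a.1 a.2))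
      (fun r : ℝ => (r : ℂ) ^ a.1 / (ζ ^ 2 - (r : ℂ) ^ 2)) (Icc 0 R) ∧
    ζ ^ (-(a.1 : ℤ) + 1) * (harmonicEval (Y a.1 a.2) θ : ℂ) *
      ∫ᵛ r in Icc 0 R, (r : ℂ) ^ a.1 / (ζ ^ 2 - (r : ℂ) ^ 2)
        ∂<•(componentMeasure μ (Y a.1 a.2)) = ∫ᵛ x, kernelTerm Y ζ θ x a ∂<•μ := by
  set f : ℝ → ℂ := fun r => (r : ℂ) ^ a.1 / (ζ ^ 2 - (r : ℂ) ^ 2) with hf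
  have hfc : ContinuousOn f (Icc 0 R) := by
    refine ContinuousOn.div (by fun_prop) (by fun_prop) fun r hr => ?_
    exact sq_sub_sq_ne_zero hr.1 (hr.2.trans_lt hζ)
  obtain ⟨D, hD⟩ := isCompact_Icc.exists_bound_of_continuousOn hfc
  have hD0 : 0 ≤ D := (norm_nonneg _).trans (hD 0 ⟨le_rfl, hR.le⟩)
  have hfm : Measurable f := by fun_prop
  obtain ⟨h1, h2⟩ := componentMeasure_setIntegral_eq μ (Y a.1 a.2) measurableSet_Icc hfm hD hD0
  refine ⟨h1, ?_⟩
  have hae : ∀ᵐ x ∂μ.variation, (Icc 0 R).indicator f ‖x‖ *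
      (harmonicEval (Y a.1 a.2) (‖x‖⁻¹ • x) : ℂ) =
      f ‖x‖ * (harmonicEval (Y a.1 a.2) (‖x‖⁻¹ • x) : ℂ) := by
    filter_upwards [hμ] with x hx
    rw [indicator_of_mem (show ‖x‖ ∈ Icc 0 R from ⟨norm_nonneg x, hx⟩)]
  have hm : Measurable fun x : EucSpace n =>
      f ‖x‖ * (harmonicEval (Y a.1 a.2) (‖x‖⁻¹ • x) : ℂ) :=
    (hfm.comp measurable_norm).mul
      (Complex.measurable_ofReal.comp (measurable_harmonicEval_normalize (Y a.1 a.2)))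
  obtain ⟨C, hC⟩ := exists_bound_harmonicEval (Y a.1 a.2)
  have hi : VectorMeasure.Integrable μ fun x : EucSpace n =>
      f ‖x‖ * (harmonicEval (Y a.1 a.2) (‖x‖⁻¹ • x) : ℂ) := by
    refine signedMeasure_integrable_of_bound μ hm.aestronglyMeasurable (C := D * C) ?_
    filter_upwards [hμ] with x hx
    rw [norm_mul, Complex.norm_real]
    exact mul_le_mul (hD _ ⟨norm_nonneg x, hx⟩) (hC x) (norm_nonneg _) hD0
  rw [h2, VectorMeasure.integral_congr_ae hae, ← signedMeasure_integral_const_mul μ _ hi]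
  rfl

end KernelExpansion

end

/-! ### Termwise integration and the uniform majorant -/

theorem mainTheorem4 (n : ℕ) (hn : 2 ≤ n)
    (Y : ∀ k : ℕ, Module.Basis (Fin (harmonicDim n k)) ℝ (harmonicSpace n k))
    (hY : IsOrthonormalHarmonicBasis n Y)
    (R : ℝ) (hR : 0 < R)
    (μ : SignedMeasure (EucSpace n))
    (hμ : μ.totalVariation (closedBall (0 : EucSpace n) R)ᶜ = 0) :
    (∀ ζ : ℂ, R < ‖ζ‖ → ∀ θ : UnitSphere n,
      VectorMeasure.Integrable μ (fun x => huaAronszajnKernel n ζ θ x) ∧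
      (∀ (k : ℕ) (l : Fin (harmonicDim n k)),
        VectorMeasure.IntegrableOn (componentMeasure μ (Y k l))
          (fun r : ℝ => (r : ℂ) ^ k / (ζ ^ 2 - (r : ℂ) ^ 2)) (Icc 0 R)) ∧
      HasSum
        (fun a : Σ k : ℕ, Fin (harmonicDim n k) =>
          ζ ^ (-(a.1 : ℤ) + 1) * (harmonicEval (Y a.1 a.2) θ : ℂ) *
            ∫ᵛ r in Icc 0 R, (r : ℂ) ^ a.1 / (ζ ^ 2 - (r : ℂ) ^ 2)
              ∂<•(componentMeasure μ (Y a.1 a.2)))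
        (stieltjesMarkov μ ζ θ)) ∧
    (∀ K : Set (KDQ n), IsCompact K → K ⊆ (closure (KDQ.ball n R))ᶜ →
      ∃ M : (Σ k : ℕ, Fin (harmonicDim n k)) → ℝ, Summable M ∧
        ∀ (ζ : ℂ) (θ : UnitSphere n), KDQ.mk ζ θ ∈ K →
          ∀ a : Σ k : ℕ, Fin (harmonicDim n k),
            ‖ζ ^ (-(a.1 : ℤ) + 1) * (harmonicEval (Y a.1 a.2) θ : ℂ) *
              ∫ᵛ r in Icc 0 R, (r : ℂ) ^ a.1 / (ζ ^ 2 - (r : ℂ) ^ 2)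
                ∂<•(componentMeasure μ (Y a.1 a.2))‖ ≤ M a) := by
  have : NeZero n := ⟨by omega⟩
  have hfin := isFiniteMeasure_variation μ
  have hae : ∀ᵐ x ∂μ.variation, ‖x‖ ≤ R := by
    rw [SignedMeasure.totalVariation_eq_variation] at hμ
    filter_upwards [measure_eq_zero_iff_ae_notMem.1 hμ] with x hx
    simpa using hx
  refine ⟨fun ζ hζ θ => ?_, fun K hK hKR => ?_⟩
  · have hθ : ‖(θ : EucSpace n)‖ = 1 := norm_eq_of_mem_sphere θ
    have hz : 0 < ‖ζ‖ := hR.trans hζ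
    set b : (Σ k : ℕ, Fin (harmonicDim n k)) → ℝ := fun a =>
      (‖ζ‖ - R)⁻¹ * (R / ‖ζ‖) ^ a.1 * zonalSeq ((n : ℝ) / 2) (1 : ℝ) 1 a.1 with hb
    have hbs : Summable b := hY.summable_bound _ (by positivity) ((div_lt_one hz).2 hζ)
    have hbound : ∀ a, ∀ᵐ x ∂μ.variation, ‖kernelTerm Y ζ θ x a‖ ≤ b a := fun a => by
      filter_upwards [hae] with x hx
      exact hY.norm_kernelTerm_le hθ hx hζ le_rfl a
    have hlim : ∀ᵐ x ∂μ.variation, HasSum (kernelTerm Y ζ θ x) (huaAronszajnKernel n ζ θ x) := by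
      filter_upwards [hae] with x hx
      exact hY.hasSum_kernelTerm hθ (hx.trans_lt hζ)
    have hmeas : Measurable fun x => huaAronszajnKernel n ζ θ x := by
      unfold huaAronszajnKernel aronszajnRoot
      fun_prop
    refine ⟨?_, fun k l => (integral_kernelTerm Y hae hR hζ θ ⟨k, l⟩).1, ?_⟩
    · refine signedMeasure_integrable_of_bound μ hmeas.aestronglyMeasurable (C := ∑' a, b a) ?_
      filter_upwards [hae] with x hx
      have h1 := hY.hasSum_kernelTerm hθ (hx.trans_lt hζ)
      rw [← h1.tsum_eq]
      exact tsum_of_norm_bounded hbs.hasSum fun a => hY.norm_kernelTerm_le hθ hx hζ le_rfl a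
    -- Dominated convergence applies because each term has a constant bound on the support and μ has
    -- finite variation. The sum over (k, ℓ) is unconditional, hence absolute in ℂ.
    · have h := signedMeasure_hasSum_integral μ
        (fun a => (measurable_kernelTerm (Y := Y) ζ θ a).aestronglyMeasurable) hbound hbs hlim
      exact h.congr_fun fun a => (integral_kernelTerm Y hae hR hζ θ a).2
  · obtain ⟨R', hR', hKn⟩ := KDQ.exists_lt_norm_of_isCompact hR hK hKR
    -- The pointwise bound for the kernel terms, times the two factors in the norm bound for a
    -- vector-measure integral: the norm of the pairing and the total variation of μ.
    refine ⟨fun a => (R' - R)⁻¹ * (R / R') ^ a.1 * zonalSeq ((n : ℝ) / 2) (1 : ℝ) 1 a.1 *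
      ‖(ContinuousLinearMap.lsmul ℝ ℝ : ℝ →L[ℝ] ℂ →L[ℝ] ℂ).flip‖ * μ.variation.real univ, ?_, ?_⟩
    · exact ((hY.summable_bound _ (div_nonneg hR.le (hR.trans hR').le)
        ((div_lt_one (hR.trans hR')).2 hR')).mul_right _).mul_right _
    · intro ζ θ hζK a
      have hζ := hKn ζ θ hζK
      have hθ : ‖(θ : EucSpace n)‖ = 1 := norm_eq_of_mem_sphere θ
      rw [(integral_kernelTerm Y hae hR (hR'.trans_le hζ) θ a).2]
      refine VectorMeasure.norm_integral_le_of_norm_le_const ?_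
      filter_upwards [hae] with x hx
      exact hY.norm_kernelTerm_le hθ hx hR' hζ a
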